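/- Let $M$ be a (Hausdorff) $C^\infty$-manifold of dimension $n\ge 2$, let $T_0M$ be its tangent bundle with the zero section removed, with induced local coordinates $(x^i,y^i)$, and let $F:TM\to[0,\infty)$ be a Finsler metric: $F$ is continuous, smooth on $T_0M$, satisfies $F(x,\lambda y)=\lambda F(x,y)$ for all $\lambda>0$, and $g_{ij}=\frac12\frac{\partial^2F^2}{\partial y^i\partial y^j}$ is non-degenerate on $T_0M$. Let $G=y^i\frac{\partial}{\partial x^i}-2G^i\frac{\partial}{\partial y^i}$ be its geodesic spray, determined by $G\big(\frac{\partial F^2}{\partial y^i}\big)-\frac{\partial F^2}{\partial x^i}=0$, and put $$N^i_j=\frac{\partial G^i}{\partial y^j},\qquad \frac{\delta}{\delta x^i}=\frac{\partial}{\partial x^i}-N^j_i\frac{\partial}{\partial y^j},\qquad R^i_{jk}=\frac{\delta N^i_j}{\delta x^k}-\frac{\delta N^i_k}{\delta x^j},$$ $$R^i_{jkl}=\frac{\partial R^i_{kl}}{\partial y^j},\qquad \chi_j=-\frac12R^i_{ijk}y^k,\qquad E_{jk}=\frac12\frac{\partial^3G^i}{\partial y^i\partial y^j\partial y^k}.$$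 Assume that the $\chi$-curvature vanishes, $\chi_j=0$ on $T_0M$, and that $F$ has scalar mean Berwald curvature $f$, i.e. $f$ is a function on $T_0M$, positively homogeneous of degree $0$ in $y$, with $$2E_{ij}=f\,\frac{\partial^2F}{\partial y^i\partial y^j}\quad\text{on }T_0M.$$ Then: 1. $f$ is a first integral of $F$: it is smooth on $T_0M$ and $G(f)=0$. 2. If $n>2$ and $M$ is connected, then $f$ is constant. 3. If $n>2$ and $M$ is compact, then $f$ vanishes identically. -/

import Mathlib

open scoped Manifold ContDiff

noncomputable section

namespace Finsler

/-! ### Calculus in induced coordinates `(x, y)` of the tangent bundle -/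

/-- The model space `ℝⁿ`. -/
abbrev Model (n : ℕ) : Type := EuclideanSpace ℝ (Fin n)

section Coordinates

variable {n : ℕ}

/-- `∂φ/∂xⁱ` for a function `φ(x, y)`. -/
def dx (i : Fin n) (φ : Model n × Model n → ℝ) (z : Model n × Model n) : ℝ :=
  fderiv ℝ φ z (EuclideanSpace.single i 1, 0)

/-- `∂φ/∂yⁱ` for a function `φ(x, y)`. -/
def dy (i : Fin n) (φ : Model n × Model n → ℝ) (z : Model n × Model n) : ℝ :=
  fderiv ℝ φ z (0, EuclideanSpace.single i 1)

/-- The metric tensor `g_{ij} = ½ ∂²F²/∂yⁱ∂yʲ`. -/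
def metricTensor (F : Model n × Model n → ℝ) (z : Model n × Model n) :
    Matrix (Fin n) (Fin n) ℝ :=
  Matrix.of fun i j => (1 / 2 : ℝ) * dy j (dy i fun w => F w ^ 2) z

/-- The coefficients `Gⁱ` of the geodesic spray `G = yⁱ ∂/∂xⁱ - 2 Gⁱ ∂/∂yⁱ`, namely
`Gⁱ = ¼ g^{ij} (yᵏ ∂²F²/∂xᵏ∂yʲ - ∂F²/∂xʲ)`.  This is the solution of the Euler-Lagrange equation
`G(∂F²/∂yⁱ) = ∂F²/∂xⁱ`, see `eulerLagrange` below. -/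
def sprayCoeff (F : Model n × Model n → ℝ) (i : Fin n) (z : Model n × Model n) : ℝ :=
  (1 / 4 : ℝ) * ∑ j, (metricTensor F z)⁻¹ i j *
    ((∑ k, z.2 k * dx k (dy j fun w => F w ^ 2) z) - dx j (fun w => F w ^ 2) z)

/-- The derivative `G(φ)` of a function `φ` along the geodesic spray of `F`. -/
def sprayDeriv (F φ : Model n × Model n → ℝ) (z : Model n × Model n) : ℝ :=
  (∑ k, z.2 k * dx k φ z) - ∑ k, 2 * sprayCoeff F k z * dy k φ z

/-- The geodesic spray satisfies the Euler-Lagrange equation of `F²`. -/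
theorem eulerLagrange (F : Model n × Model n → ℝ) (z : Model n × Model n)
    (hz : (metricTensor F z).det ≠ 0) (i : Fin n) :
    sprayDeriv F (dy i fun w => F w ^ 2) z - dx i (fun w => F w ^ 2) z = 0 := by
  set b : Fin n → ℝ := fun j =>
    (∑ k, z.2 k * dx k (dy j fun w => F w ^ 2) z) - dx j (fun w => F w ^ 2) z with hb
  have h1 : (fun k => sprayCoeff F k z) =
      (1 / 4 : ℝ) • Matrix.mulVec (metricTensor F z)⁻¹ b := by
    funext k
    simp [sprayCoeff, Matrix.mulVec, dotProduct, hb]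
  have h2 : Matrix.mulVec (metricTensor F z) (fun k => sprayCoeff F k z) = (1 / 4 : ℝ) • b := by
    rw [h1, Matrix.mulVec_smul, Matrix.mulVec_mulVec,
      Matrix.mul_nonsing_inv _ (isUnit_iff_ne_zero.mpr hz), Matrix.one_mulVec]
  have h3 := congrFun h2 i
  have h4 : ∑ k, 2 * sprayCoeff F k z * dy k (dy i fun w => F w ^ 2) z =
      4 * Matrix.mulVec (metricTensor F z) (fun k => sprayCoeff F k z) i := by
    simp only [Matrix.mulVec, dotProduct, metricTensor, Matrix.of_apply, Finset.mul_sum]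
    exact Finset.sum_congr rfl fun k _ => by ring
  unfold sprayDeriv
  rw [h4, h3]
  simp only [Pi.smul_apply, smul_eq_mul, hb]
  ring

/-- The coefficients `Nⁱ_j = ∂Gⁱ/∂yʲ` of the canonical nonlinear connection. -/
def connCoeff (F : Model n × Model n → ℝ) (i j : Fin n) : Model n × Model n → ℝ :=
  dy j (sprayCoeff F i)

/-- The horizontal derivative `δφ/δxⁱ = ∂φ/∂xⁱ - Nᵐ_i ∂φ/∂yᵐ`. -/
def horDeriv (F : Model n × Model n → ℝ) (i : Fin n) (φ : Model n × Model n → ℝ)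
    (z : Model n × Model n) : ℝ :=
  dx i φ z - ∑ m, connCoeff F m i z * dy m φ z

/-- The curvature `Rⁱ_{jk} = δNⁱ_j/δxᵏ - δNⁱ_k/δxʲ` of the nonlinear connection. -/
def curvature (F : Model n × Model n → ℝ) (i j k : Fin n) (z : Model n × Model n) : ℝ :=
  horDeriv F k (connCoeff F i j) z - horDeriv F j (connCoeff F i k) z

/-- The Riemannian curvature `Rⁱ_{jkl} = ∂Rⁱ_{kl}/∂yʲ` of the Berwald connection. -/
def riemannCurvature (F : Model n × Model n → ℝ) (i j k l : Fin n) :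
    Model n × Model n → ℝ :=
  dy j (curvature F i k l)

/-- The `χ`-curvature `χ_j = -½ Rⁱ_{ijk} yᵏ`. -/
def chiCurvature (F : Model n × Model n → ℝ) (j : Fin n) (z : Model n × Model n) : ℝ :=
  -(1 / 2 : ℝ) * ∑ i, ∑ k, riemannCurvature F i i j k z * z.2 k

/-- The Berwald curvature `Bⁱ_{jkl} = ∂³Gⁱ/∂yʲ∂yᵏ∂yˡ`. -/
def berwaldCurvature (F : Model n × Model n → ℝ) (i j k l : Fin n) :
    Model n × Model n → ℝ :=
  dy j (dy k (dy l (sprayCoeff F i)))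

/-- The mean Berwald curvature `E_{jk} = ½ Bⁱ_{ijk}`. -/
def meanBerwald (F : Model n × Model n → ℝ) (j k : Fin n) (z : Model n × Model n) : ℝ :=
  (1 / 2 : ℝ) * ∑ i, berwaldCurvature F i i j k z

end Coordinates

/-! ### Finsler structures on a manifold -/

section Manifold

variable {n : ℕ} {M : Type*} [TopologicalSpace M] [ChartedSpace (Model n) M]

/-- The slit tangent bundle `T₀M`. -/
def slit (n : ℕ) (M : Type*) [TopologicalSpace M] [ChartedSpace (Model n) M] :
    Set (TangentBundle (𝓡 n) M) :=
  {v | v.2 ≠ 0}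

/-- The expression of a function on `TM` in the coordinates `(x, y)` induced by a chart `e` of `M`:
`(x, y)` stands for the tangent vector `yⁱ ∂/∂xⁱ` at the point with coordinates `x`. -/
def inChart (e : OpenPartialHomeomorph M (Model n)) (φ : TangentBundle (𝓡 n) M → ℝ)
    (z : Model n × Model n) : ℝ :=
  φ ⟨e.symm z.1, mfderiv (𝓡 n) (𝓡 n) e.symm z.1 z.2⟩

/-- `P e z` holds for every smooth chart `e` of `M` and all `z = (x, y)` that are the induced
coordinates of a point of `T₀M`. -/
def InAllCharts (P : OpenPartialHomeomorph M (Model n) → Model n × Model n → Prop) : Prop :=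
  ∀ e ∈ IsManifold.maximalAtlas (𝓡 n) ∞ M, ∀ x ∈ e.target, ∀ y : Model n, y ≠ 0 → P e (x, y)

/-- `φ(x, λ y) = λ^r φ(x, y)` on `T₀M` for all `λ > 0`. -/
def PosHomogeneous (r : ℕ) (φ : TangentBundle (𝓡 n) M → ℝ) : Prop :=
  ∀ (p : M) (v : TangentSpace (𝓡 n) p), v ≠ 0 → ∀ c : ℝ, 0 < c →
    φ ⟨p, c • v⟩ = c ^ r * φ ⟨p, v⟩

/-- Finsler structures (Finsler metrics) on `M`. -/
structure IsFinsler [IsManifold (𝓡 n) ∞ M] (F : TangentBundle (𝓡 n) M → ℝ) : Prop where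
  nonneg : ∀ v, 0 ≤ F v
  continuous : Continuous F
  smooth : ContMDiffOn (𝓡 n).tangent 𝓘(ℝ, ℝ) ∞ F (slit n M)
  homogeneous : PosHomogeneous 1 F
  nondegenerate : InAllCharts fun e z => (metricTensor (inChart e F) z).det ≠ 0

/-- The `χ`-curvature of `F` vanishes. -/
def ChiVanishes (F : TangentBundle (𝓡 n) M → ℝ) : Prop :=
  InAllCharts fun e z => ∀ j, chiCurvature (inChart e F) j z = 0

/-- `F` has scalar mean Berwald curvature `f`: `f` is a `0⁺`-homogeneous function on `T₀M` with
`2 E_{ij} = f ∂²F/∂yⁱ∂yʲ`. -/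
def HasScalarMeanBerwald (F f : TangentBundle (𝓡 n) M → ℝ) : Prop :=
  PosHomogeneous 0 f ∧
  InAllCharts fun e z => ∀ i j, 2 * meanBerwald (inChart e F) i j z =
    inChart e f z * dy i (dy j (inChart e F)) z

/-- `f` is a first integral of `F`: it is smooth on `T₀M` and `G(f) = 0` for the geodesic
spray `G` of `F`. -/
def IsFirstIntegral [IsManifold (𝓡 n) ∞ M] (F f : TangentBundle (𝓡 n) M → ℝ) : Prop :=
  ContMDiffOn (𝓡 n).tangent 𝓘(ℝ, ℝ) ∞ f (slit n M) ∧
  InAllCharts fun e z => sprayDeriv (inChart e F) (inChart e f) z = 0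

end Manifold

end Finsler

end

/-! Let `S` be the geodesic spray and τ = ∂Gⁱ/∂yⁱ (`traceN`). Since 2E_{ij} = ∂²τ/∂yⁱ∂yʲ, the
hypothesis on f compares two vertical Hessians: τ_{ij} = f F_{ij}. Tracing the curvature shows that
χ = 0 is the Euler-Lagrange equation S(∂τ/∂yʲ) = ∂τ/∂xʲ (`S_Y_traceN`), which F satisfies as well
(`S_Y_F`). The vertical Hessian of every solution obeys the same linear transport law along S
(`spray_hessian`), so comparing τ with F leaves S(f) F_{ij} = 0. The angular metric F F_{ij} =
g_{ij} - F_i F_j has trace n - 1 (`sum_ginv_hess_F`), hence S(f) = 0. The same trace recovers f from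
E, which gives its smoothness.

If n > 2, symmetry of the third vertical derivatives of τ gives f_k F_{ij} = f_j F_{ik}. Its trace
is (n - 1) f_k = f_k, because y^j f_j = 0. So f depends on x only, and differentiating S(f) = 0 in y
gives ∂f/∂x = 0: f is locally constant, and constant when M is connected.

If M is compact, the vertical Hessian of τ - fF vanishes, so τ = fF + a_k(x) yᵏ in a chart. Put W =
|det g| and L = ½ log |det g|. The measure W dx dy does not depend on the chart and is preserved by
S, and S(L) = τ (`S_W`, `S_L`). Against a cutoff θ'(F²/2), fibrewise linear functions integrate to
zero (`linear`), while integrating fF gives a negative multiple of the integral of f θ(F²/2)/F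
(`homogeneous`). Were L globally defined, invariance of the measure would make the integral of f
S(L) θ' vanish, hence that of f² θ/F, and f would be zero. A change of chart alters L by a function
of x, whose derivative along S is fibrewise linear and thus invisible. A partition of unity turns
this into a proof (`integral_flux`, `integral_flux_one`).

The differential identities are proved in a commutative algebra with commuting derivations, free of
smoothness side conditions, and then applied to smooth functions on open sets of coordinates (x, y).
-/

noncomputable section

namespace Finsler

/-! ### Derivations of determinants and inverse matrices -/

section Derivations

variable {A : Type*} [CommRing A] [Algebra ℝ A]

theorem derivation_mul (D : Derivation ℝ A A) (a b : A) : D (a * b) = a * D b + b * D a := by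
  simp [D.leibniz]

theorem derivation_prod {ι : Type*} [DecidableEq ι] (D : Derivation ℝ A A) (s : Finset ι)
    (u : ι → A) : D (∏ i ∈ s, u i) = ∑ j ∈ s, (∏ i ∈ s.erase j, u i) * D (u j) := by
  induction s using Finset.induction_on with
  | empty => simp
  | insert a s ha ih =>
    rw [Finset.prod_insert ha, derivation_mul, ih, Finset.sum_insert ha, Finset.erase_insert ha,
      Finset.mul_sum, add_comm]
    congr 1
    refine Finset.sum_congr rfl fun j hj => ?_
    have hne : a ≠ j := fun h => ha (h ▸ hj)
    rw [Finset.erase_insert_of_ne hne, Finset.prod_insert (fun h => ha (Finset.mem_of_mem_erase h))]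
    ring

theorem derivation_sum_apply {ι : Type*} (s : Finset ι) (D : ι → Derivation ℝ A A) (a : A) :
    (∑ i ∈ s, D i) a = ∑ i ∈ s, D i a := by
  classical
  induction s using Finset.induction_on with
  | empty => simp
  | insert i s hi ih => rw [Finset.sum_insert hi, Finset.sum_insert hi, Derivation.add_apply, ih]

/-- Jacobi's formula for the derivative of a determinant. -/
theorem derivation_det {n : ℕ} (D : Derivation ℝ A A) (g h : Matrix (Fin n) (Fin n) A)
    (hg : h * g = 1) : D g.det = g.det * ∑ i, ∑ j, h i j * D (g j i) := by
  have hadj : g.adjugate = g.det • h := by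
    have : h * g * g.adjugate = g.det • h := by
      rw [Matrix.mul_assoc, Matrix.mul_adjugate, Matrix.mul_smul, Matrix.mul_one]
    rwa [hg, Matrix.one_mul] at this
  -- The Leibniz rule differentiates one column at a time; by Cramer's rule each resulting
  -- determinant is an entry of the adjugate applied to the differentiated column.
  have h1 : D g.det = ∑ j, (g.updateCol j fun i => D (g i j)).det := by
    simp only [Matrix.det_apply, map_sum]
    rw [Finset.sum_comm]
    refine Finset.sum_congr rfl fun σ _ => ?_
    rw [Units.smul_def, D.map_smul_of_tower, derivation_prod, Finset.smul_sum]
    refine Finset.sum_congr rfl fun j _ => ?_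
    rw [Units.smul_def, ← Finset.mul_prod_erase Finset.univ _ (Finset.mem_univ j),
      Matrix.updateCol_self, mul_comm]
    congr 2
    refine Finset.prod_congr rfl fun i hi => ?_
    rw [Matrix.updateCol_ne (Finset.ne_of_mem_erase hi)]
  rw [h1, Finset.mul_sum]
  refine Finset.sum_congr rfl fun j _ => ?_
  rw [← Matrix.cramer_apply, Matrix.cramer_eq_adjugate_mulVec, hadj, Finset.mul_sum]
  simp [Matrix.mulVec, dotProduct, mul_assoc]

/-- Differentiating h g = 1 and multiplying by h on the right gives Dh = -h (Dg) h. -/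
theorem derivation_inv {n : ℕ} (D : Derivation ℝ A A) (g h : Matrix (Fin n) (Fin n) A)
    (hg : h * g = 1) (i l : Fin n) :
    D (h i l) = -∑ j, ∑ k, h i j * D (g j k) * h k l := by
  have hg' : g * h = 1 := mul_eq_one_comm.mp hg
  have h0 : ∀ k, ∑ j, (h i j * D (g j k) + g j k * D (h i j)) = 0 := fun k => by
    have := congrArg D (congrFun (congrFun hg i) k)
    rw [Matrix.mul_apply, map_sum] at this
    simp only [derivation_mul] at this
    rw [this, Matrix.one_apply]
    split_ifs <;> simp
  have h1 : ∑ k, (∑ j, (h i j * D (g j k) + g j k * D (h i j))) * h k l = 0 :=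
    Finset.sum_eq_zero fun k _ => by rw [h0 k, zero_mul]
  have h2 : ∑ k, ∑ j, g j k * D (h i j) * h k l = D (h i l) := by
    rw [Finset.sum_comm]
    have : ∀ j, ∑ k, g j k * D (h i j) * h k l = D (h i j) * (1 : Matrix (Fin n) (Fin n) A) j l := by
      intro j
      rw [← hg', Matrix.mul_apply, Finset.mul_sum]
      exact Finset.sum_congr rfl fun k _ => by ring
    simp [this, Matrix.one_apply]
  simp only [Finset.sum_mul, add_mul, Finset.sum_add_distrib] at h1
  rw [h2, Finset.sum_comm] at h1
  linear_combination h1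

end Derivations

/-! ### The algebra of smooth functions on an open cone in the tangent bundle -/

/-- A commutative algebra with the structure of the algebra of smooth functions of the coordinates
`(x, y)`: `X i` and `Y i` stand for `∂/∂xⁱ` and `∂/∂yⁱ`. -/
structure PhaseAlgebra (n : ℕ) (A : Type*) [CommRing A] [Algebra ℝ A] where
  X : Fin n → Derivation ℝ A A
  Y : Fin n → Derivation ℝ A A
  y : Fin n → A
  Y_X : ∀ i j a, Y i (X j a) = X j (Y i a)
  Y_Y : ∀ i j a, Y i (Y j a) = Y j (Y i a)
  X_y : ∀ i j, X i (y j) = 0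
  Y_y : ∀ i j, Y i (y j) = if i = j then 1 else 0

/-- A Finsler metric `F` with metric tensor `g` and spray coefficients `G` in a `PhaseAlgebra`. -/
structure FinslerAlgebra (n : ℕ) (A : Type*) [CommRing A] [Algebra ℝ A] extends
    PhaseAlgebra n A where
  F : A
  Finv : A
  F_inv : F * Finv = 1
  euler : ∑ k, y k * Y k F = F
  g : Matrix (Fin n) (Fin n) A
  ginv : Matrix (Fin n) (Fin n) A
  two_g : ∀ i j, 2 * g i j = Y j (Y i (F * F))
  ginv_mul : ginv * g = 1
  G : Fin n → A
  eulerLagrange : ∀ i, (∑ k, y k * X k (Y i (F * F))) - ∑ k, 2 * G k * Y k (Y i (F * F)) =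
    X i (F * F)

section TwoCancel

variable {A : Type*} [CommRing A] [Algebra ℝ A]

theorem two_cancel {a b : A} (h : 2 * a = 2 * b) : a = b := by
  have h2 : algebraMap ℝ A (1 / 2) * 2 = 1 := by
    have : (2 : A) = algebraMap ℝ A 2 := (map_ofNat (algebraMap ℝ A) 2).symm
    rw [this, ← map_mul]; norm_num
  calc a = algebraMap ℝ A (1 / 2) * 2 * a := by rw [h2, one_mul]
    _ = algebraMap ℝ A (1 / 2) * 2 * b := by rw [mul_assoc, h, ← mul_assoc]
    _ = b := by rw [h2, one_mul]

theorem natCast_cancel {m : ℕ} (hm : m ≠ 0) {a : A} (h : (m : A) * a = 0) : a = 0 := by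
  have h2 : algebraMap ℝ A (m : ℝ)⁻¹ * (m : A) = 1 := by
    have : (m : A) = algebraMap ℝ A m := (map_natCast (algebraMap ℝ A) m).symm
    rw [this, ← map_mul, inv_mul_cancel₀ (by exact_mod_cast hm), map_one]
  rw [← one_mul a, ← h2, mul_assoc, h, mul_zero]

end TwoCancel

namespace PhaseAlgebra

variable {n : ℕ} {A : Type*} [CommRing A] [Algebra ℝ A] (J : PhaseAlgebra n A)

/-- The Liouville vector field `yᵏ ∂/∂yᵏ`. -/
def C : Derivation ℝ A A := ∑ k, J.y k • J.Y k

/-- The second order vector field `yᵏ ∂/∂xᵏ - 2 Gᵏ ∂/∂yᵏ`. -/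
def spray (G : Fin n → A) : Derivation ℝ A A := ∑ k, J.y k • J.X k - ∑ k, (2 * G k) • J.Y k

theorem C_apply (a : A) : J.C a = ∑ k, J.y k * J.Y k a := by
  simp [C, derivation_sum_apply]

theorem spray_apply (G : Fin n → A) (a : A) :
    J.spray G a = ∑ k, J.y k * J.X k a - ∑ k, 2 * G k * J.Y k a := by
  simp [spray, derivation_sum_apply]

theorem Y_two_mul (k : Fin n) (a : A) : J.Y k (2 * a) = 2 * J.Y k a := by
  have : J.Y k (2 : A) = 0 := by simpa using (J.Y k).map_natCast 2
  rw [derivation_mul, this]; ring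

theorem C_y (k : Fin n) : J.C (J.y k) = J.y k := by
  simp [C_apply, J.Y_y]

theorem spray_y (G : Fin n → A) (k : Fin n) : J.spray G (J.y k) = -(2 * G k) := by
  simp [spray_apply, J.Y_y, J.X_y]

theorem Y_C (k : Fin n) (a : A) : J.Y k (J.C a) = J.C (J.Y k a) + J.Y k a := by
  simp only [C_apply, map_sum, derivation_mul, J.Y_y, Finset.sum_add_distrib]
  congr 1
  · exact Finset.sum_congr rfl fun i _ => by rw [J.Y_Y]
  · simp

theorem X_C (k : Fin n) (a : A) : J.X k (J.C a) = J.C (J.X k a) := by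
  simp only [C_apply, map_sum, derivation_mul, J.X_y, mul_zero, add_zero]
  exact Finset.sum_congr rfl fun i _ => by rw [J.Y_X]

/-- The commutator of ∂/∂yᵏ with the spray. The term `J.X k a` comes from differentiating the
coefficient yᵏ; it is what links vertical information to derivatives in x. -/
theorem Y_spray (G : Fin n → A) (k : Fin n) (a : A) :
    J.Y k (J.spray G a) = J.spray G (J.Y k a) + J.X k a - 2 * ∑ m, J.Y k (G m) * J.Y m a := by
  have h1 : ∀ i, J.Y k (J.y i * J.X i a) =
      J.y i * J.X i (J.Y k a) + if k = i then J.X i a else 0 := fun i => by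
    rw [derivation_mul, J.Y_X, J.Y_y]; split_ifs <;> simp
  have h2 : ∀ i, J.Y k (2 * G i * J.Y i a) =
      2 * G i * J.Y i (J.Y k a) + 2 * (J.Y k (G i) * J.Y i a) := fun i => by
    rw [derivation_mul, J.Y_Y, Y_two_mul]; ring
  simp only [spray_apply, map_sub, map_sum, h1, h2, Finset.sum_add_distrib, Finset.mul_sum,
    Finset.sum_ite_eq, Finset.mem_univ, if_true]
  ring

/-- If `φ` satisfies the Euler-Lagrange equation of the spray, then its vertical Hessian is parallel
along the spray. -/
theorem spray_hessian (G : Fin n → A) {a : A} (ha : ∀ j, J.spray G (J.Y j a) = J.X j a)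
    (j k : Fin n) : J.spray G (J.Y j (J.Y k a)) =
      ∑ m, J.Y k (G m) * J.Y m (J.Y j a) + ∑ m, J.Y j (G m) * J.Y m (J.Y k a) := by
  -- The commutator is used with the two indices in both orders. In the sum of the two identities
  -- the mixed derivatives ∂²/∂x∂y cancel.
  have h1 := J.Y_spray G j (J.Y k a)
  have h2 := J.Y_spray G k (J.Y j a)
  rw [ha, J.Y_X] at h1 h2
  rw [J.Y_Y k j] at h2
  apply two_cancel
  linear_combination -h1 - h2

end PhaseAlgebra

end Finsler
end

/-! ### Homogeneity, Euler-Lagrange equations and the trace of the connection. -/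

noncomputable section

namespace Finsler

namespace FinslerAlgebra

variable {n : ℕ} {A : Type*} [CommRing A] [Algebra ℝ A] (Φ : FinslerAlgebra n A)

/-- The geodesic spray. -/
def S : Derivation ℝ A A := Φ.spray Φ.G

/-- The trace `∂Gⁱ/∂yⁱ` of the nonlinear connection. -/
def traceN : A := ∑ i, Φ.Y i (Φ.G i)

theorem S_apply (a : A) : Φ.S a = ∑ k, Φ.y k * Φ.X k a - ∑ k, 2 * Φ.G k * Φ.Y k a :=
  Φ.spray_apply Φ.G a

theorem mul_ginv : Φ.g * Φ.ginv = 1 := mul_eq_one_comm.mp Φ.ginv_mul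

theorem g_symm (i j : Fin n) : Φ.g i j = Φ.g j i :=
  two_cancel (by rw [Φ.two_g, Φ.two_g, Φ.Y_Y])

theorem ginv_symm (i j : Fin n) : Φ.ginv i j = Φ.ginv j i := by
  have ht : Φ.g.transpose = Φ.g := by ext i j; exact Φ.g_symm j i
  have h1 : Φ.ginv.transpose * Φ.g = 1 := by
    have := congrArg Matrix.transpose Φ.mul_ginv
    rwa [Matrix.transpose_mul, ht, Matrix.transpose_one] at this
  have h2 : Φ.ginv.transpose = Φ.ginv := by
    calc Φ.ginv.transpose = Φ.ginv.transpose * (Φ.g * Φ.ginv) := by rw [Φ.mul_ginv, Matrix.mul_one]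
      _ = Φ.ginv := by rw [← Matrix.mul_assoc, h1, Matrix.one_mul]
  exact congrFun (congrFun h2 j) i

theorem eq_zero_of_g_mul {u : Fin n → A} (h : ∀ i, ∑ j, Φ.g i j * u j = 0) : u = 0 := by
  have h1 : Φ.g.mulVec u = 0 := funext h
  have h2 : Φ.ginv.mulVec (Φ.g.mulVec u) = u := by
    rw [Matrix.mulVec_mulVec, Φ.ginv_mul, Matrix.one_mulVec]
  rw [← h2, h1, Matrix.mulVec_zero]

theorem F_cancel {a b : A} (h : Φ.F * a = Φ.F * b) : a = b := by
  linear_combination Φ.Finv * h + (b - a) * Φ.F_inv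

theorem C_F : Φ.C Φ.F = Φ.F := by rw [Φ.C_apply, Φ.euler]

theorem C_FF : Φ.C (Φ.F * Φ.F) = 2 * (Φ.F * Φ.F) := by
  rw [derivation_mul, Φ.C_F]; ring

theorem C_Y_F (i : Fin n) : Φ.C (Φ.Y i Φ.F) = 0 := by
  have := Φ.Y_C i Φ.F
  rw [Φ.C_F] at this
  linear_combination -this

theorem Y_FF (i : Fin n) : Φ.Y i (Φ.F * Φ.F) = 2 * (Φ.F * Φ.Y i Φ.F) := by
  rw [derivation_mul]; ring

theorem g_eq (i j : Fin n) : Φ.g i j = Φ.Y i Φ.F * Φ.Y j Φ.F + Φ.F * Φ.Y i (Φ.Y j Φ.F) := by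
  apply two_cancel
  rw [Φ.two_g, Φ.Y_FF, Φ.Y_two_mul, derivation_mul, Φ.Y_Y j i]
  ring

theorem sum_g_y (i : Fin n) : ∑ j, Φ.g i j * Φ.y j = Φ.F * Φ.Y i Φ.F := by
  simp only [g_eq, add_mul, Finset.sum_add_distrib]
  have h1 : ∑ j, Φ.Y i Φ.F * Φ.Y j Φ.F * Φ.y j = Φ.F * Φ.Y i Φ.F := by
    rw [← Φ.C_F, Φ.C_apply, Finset.sum_mul]
    simp only [Φ.euler]
    exact Finset.sum_congr rfl fun j _ => by ring
  have h2 : ∑ j, Φ.F * Φ.Y i (Φ.Y j Φ.F) * Φ.y j = Φ.F * Φ.C (Φ.Y i Φ.F) := by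
    rw [Φ.C_apply, Finset.mul_sum]
    exact Finset.sum_congr rfl fun j _ => by rw [Φ.Y_Y i j]; ring
  rw [h1, h2, Φ.C_Y_F]; ring

theorem sum_ginv_Y_F (i : Fin n) : Φ.F * ∑ j, Φ.ginv i j * Φ.Y j Φ.F = Φ.y i := by
  have h : Φ.ginv.mulVec (Φ.g.mulVec Φ.y) i = Φ.y i := by
    rw [Matrix.mulVec_mulVec, Φ.ginv_mul, Matrix.one_mulVec]
  rw [← h, Matrix.mulVec, dotProduct, Finset.mul_sum]
  refine Finset.sum_congr rfl fun j _ => ?_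
  rw [Matrix.mulVec, dotProduct, Φ.sum_g_y]; ring

theorem sum_ginv_g : ∑ i, ∑ j, Φ.ginv i j * Φ.g i j = (n : A) := by
  have h : ∀ i, ∑ j, Φ.ginv i j * Φ.g i j = 1 := fun i => by
    have := congrFun (congrFun Φ.ginv_mul i) i
    rw [Matrix.mul_apply, Matrix.one_apply_eq] at this
    rw [← this]
    exact Finset.sum_congr rfl fun j _ => by rw [Φ.g_symm]
  simp [h]

theorem sum_ginv_Y_F_Y_F : ∑ i, ∑ j, Φ.ginv i j * (Φ.Y i Φ.F * Φ.Y j Φ.F) = 1 := by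
  apply Φ.F_cancel
  have : ∀ i, Φ.F * ∑ j, Φ.ginv i j * (Φ.Y i Φ.F * Φ.Y j Φ.F) = Φ.y i * Φ.Y i Φ.F := fun i => by
    rw [← Φ.sum_ginv_Y_F i, Finset.mul_sum, Finset.mul_sum, Finset.sum_mul]
    exact Finset.sum_congr rfl fun j _ => by ring
  rw [Finset.mul_sum]
  simp only [this, Φ.euler, mul_one]

/-- F F_{ij} = g_{ij} - F_i F_j, and the two terms have traces n and 1. Every factor n - 1 below
originates here. -/
theorem sum_ginv_hess_F :
    Φ.F * ∑ i, ∑ j, Φ.ginv i j * Φ.Y i (Φ.Y j Φ.F) = (n : A) - 1 := by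
  rw [← Φ.sum_ginv_g, ← Φ.sum_ginv_Y_F_Y_F, Finset.mul_sum, ← Finset.sum_sub_distrib]
  refine Finset.sum_congr rfl fun i _ => ?_
  rw [Finset.mul_sum, ← Finset.sum_sub_distrib]
  refine Finset.sum_congr rfl fun j _ => ?_
  rw [Φ.g_eq]; ring

theorem spray_Y_FF (i : Fin n) : Φ.S (Φ.Y i (Φ.F * Φ.F)) = Φ.X i (Φ.F * Φ.F) := by
  rw [Φ.S_apply, Φ.eulerLagrange]

theorem C_y_mul (a : A) (k : Fin n) : Φ.C (Φ.y k * a) = Φ.y k * a + Φ.y k * Φ.C a := by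
  rw [derivation_mul, Φ.C_y]; ring

theorem C_two_mul (a : A) : Φ.C (2 * a) = 2 * Φ.C a := by
  rw [derivation_mul, show (2 : A) = ((2 : ℕ) : A) by norm_num, Derivation.map_natCast]; ring

/-- Applying the Liouville field to the Euler-Lagrange equation, whose other ingredients have known
degrees, shows that g annihilates the vector C(G) - 2G; g is invertible. -/
theorem C_G (i : Fin n) : Φ.C (Φ.G i) = 2 * Φ.G i := by
  have hC : ∀ i, Φ.C (Φ.Y i (Φ.F * Φ.F)) = Φ.Y i (Φ.F * Φ.F) := fun i => by
    have := Φ.Y_C i (Φ.F * Φ.F)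
    rw [Φ.C_FF, Φ.Y_two_mul] at this
    linear_combination -this
  have hCC : ∀ i k, Φ.C (Φ.Y k (Φ.Y i (Φ.F * Φ.F))) = 0 := fun i k => by
    have := Φ.Y_C k (Φ.Y i (Φ.F * Φ.F))
    rw [hC] at this
    linear_combination -this
  have h : (fun k => Φ.C (Φ.G k) - 2 * Φ.G k) = 0 := by
    refine Φ.eq_zero_of_g_mul fun i => ?_
    have h1 := congrArg Φ.C (Φ.eulerLagrange i)
    rw [← Φ.X_C, Φ.C_FF, map_sub, map_sum, map_sum] at h1
    have h2 : ∑ k, Φ.C (Φ.y k * Φ.X k (Φ.Y i (Φ.F * Φ.F))) =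
        2 * ∑ k, Φ.y k * Φ.X k (Φ.Y i (Φ.F * Φ.F)) := by
      rw [Finset.mul_sum]
      refine Finset.sum_congr rfl fun k _ => ?_
      rw [Φ.C_y_mul, ← Φ.X_C, hC]; ring
    have h3 : ∑ k, Φ.C (2 * Φ.G k * Φ.Y k (Φ.Y i (Φ.F * Φ.F))) =
        ∑ k, 2 * Φ.C (Φ.G k) * Φ.Y k (Φ.Y i (Φ.F * Φ.F)) := by
      refine Finset.sum_congr rfl fun k _ => ?_
      rw [derivation_mul, hCC, C_two_mul]; ring
    have h4 : Φ.X i (2 * (Φ.F * Φ.F)) = 2 * Φ.X i (Φ.F * Φ.F) := by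
      rw [two_mul, map_add]; ring
    have h5 : 4 * ∑ j, Φ.g i j * (Φ.C (Φ.G j) - 2 * Φ.G j) =
        ∑ k, 2 * Φ.C (Φ.G k) * Φ.Y k (Φ.Y i (Φ.F * Φ.F)) -
          2 * ∑ k, 2 * Φ.G k * Φ.Y k (Φ.Y i (Φ.F * Φ.F)) := by
      rw [Finset.mul_sum, Finset.mul_sum, ← Finset.sum_sub_distrib]
      exact Finset.sum_congr rfl fun k _ => by rw [← Φ.two_g]; ring
    rw [h2, h3, h4] at h1
    apply two_cancel
    apply two_cancel
    linear_combination h5 - h1 + 2 * Φ.eulerLagrange i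
  have := congrFun h i
  simp only [Pi.zero_apply] at this
  linear_combination this

theorem C_traceN : Φ.C Φ.traceN = Φ.traceN := by
  rw [traceN, map_sum]
  refine Finset.sum_congr rfl fun i _ => ?_
  have := Φ.Y_C i (Φ.G i)
  rw [Φ.C_G, Φ.Y_two_mul] at this
  linear_combination -this

theorem S_FF : Φ.S (Φ.F * Φ.F) = 0 := by
  have h1 : Φ.S (∑ i, Φ.y i * Φ.Y i (Φ.F * Φ.F)) = Φ.S (2 * (Φ.F * Φ.F)) := by
    rw [← Φ.C_apply, Φ.C_FF]
  rw [map_sum, two_mul, map_add] at h1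
  have h2 : ∑ i, Φ.S (Φ.y i * Φ.Y i (Φ.F * Φ.F)) = Φ.S (Φ.F * Φ.F) := by
    rw [Φ.S_apply (Φ.F * Φ.F), ← Finset.sum_sub_distrib]
    refine Finset.sum_congr rfl fun i _ => ?_
    rw [derivation_mul, spray_Y_FF, S, Φ.spray_y]; ring
  linear_combination h2 - h1

theorem S_F : Φ.S Φ.F = 0 := by
  have h := Φ.S_FF
  rw [derivation_mul] at h
  apply Φ.F_cancel
  apply two_cancel
  linear_combination h

/-- The Euler-Lagrange equation passes from F² to F because F is constant along the spray and
invertible. -/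
theorem S_Y_F (i : Fin n) : Φ.S (Φ.Y i Φ.F) = Φ.X i Φ.F := by
  have h := Φ.spray_Y_FF i
  rw [derivation_mul, derivation_mul, map_add, derivation_mul, Φ.S_F] at h
  apply Φ.F_cancel
  apply two_cancel
  linear_combination h

/-! ### Curvature -/

/-- The horizontal derivative `δ/δxᵏ`. -/
def hor (k : Fin n) (a : A) : A := Φ.X k a - ∑ m, Φ.Y k (Φ.G m) * Φ.Y m a

/-- The curvature of the nonlinear connection. -/
def curv (i j k : Fin n) : A := Φ.hor k (Φ.Y j (Φ.G i)) - Φ.hor j (Φ.Y k (Φ.G i))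

theorem sum_Y_hor (j k : Fin n) : ∑ i, Φ.Y i (Φ.hor k (Φ.Y j (Φ.G i))) =
    Φ.hor k (Φ.Y j Φ.traceN) - ∑ i, ∑ m, Φ.Y i (Φ.Y k (Φ.G m)) * Φ.Y m (Φ.Y j (Φ.G i)) := by
  have h : ∀ i, Φ.Y i (Φ.hor k (Φ.Y j (Φ.G i))) = Φ.hor k (Φ.Y j (Φ.Y i (Φ.G i))) -
      ∑ m, Φ.Y i (Φ.Y k (Φ.G m)) * Φ.Y m (Φ.Y j (Φ.G i)) := fun i => by
    simp only [hor, map_sub, map_sum, derivation_mul, Finset.sum_add_distrib, Φ.Y_X]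
    rw [Φ.Y_Y i j]
    have h1 : ∑ m, Φ.Y k (Φ.G m) * Φ.Y i (Φ.Y m (Φ.Y j (Φ.G i))) =
        ∑ m, Φ.Y k (Φ.G m) * Φ.Y m (Φ.Y j (Φ.Y i (Φ.G i))) :=
      Finset.sum_congr rfl fun m _ => by rw [Φ.Y_Y i m, Φ.Y_Y i j]
    have h2 : ∑ m, Φ.Y m (Φ.Y j (Φ.G i)) * Φ.Y i (Φ.Y k (Φ.G m)) =
        ∑ m, Φ.Y i (Φ.Y k (Φ.G m)) * Φ.Y m (Φ.Y j (Φ.G i)) :=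
      Finset.sum_congr rfl fun m _ => mul_comm _ _
    rw [h1, h2]; ring
  have h3 : ∑ i, Φ.hor k (Φ.Y j (Φ.Y i (Φ.G i))) = Φ.hor k (Φ.Y j Φ.traceN) := by
    simp only [hor, traceN, map_sum, Finset.sum_sub_distrib, Finset.mul_sum]
    rw [Finset.sum_comm]
  simp only [h, Finset.sum_sub_distrib, h3]

/-- Tracing past the horizontal derivative costs a term quadratic in ∂N/∂y. That term is symmetric
in j and k, so it drops out of the antisymmetrized curvature. -/
theorem sum_Y_curv (j k : Fin n) : ∑ i, Φ.Y i (Φ.curv i j k) =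
    Φ.hor k (Φ.Y j Φ.traceN) - Φ.hor j (Φ.Y k Φ.traceN) := by
  simp only [curv, map_sub, Finset.sum_sub_distrib, sum_Y_hor]
  have : ∑ i, ∑ m, Φ.Y i (Φ.Y k (Φ.G m)) * Φ.Y m (Φ.Y j (Φ.G i)) =
      ∑ i, ∑ m, Φ.Y i (Φ.Y j (Φ.G m)) * Φ.Y m (Φ.Y k (Φ.G i)) := by
    rw [Finset.sum_comm]
    exact Finset.sum_congr rfl fun i _ => Finset.sum_congr rfl fun m _ => mul_comm _ _
  rw [this]; ring

theorem sum_y_Y_G (m : Fin n) : ∑ k, Φ.y k * Φ.Y k (Φ.G m) = 2 * Φ.G m := by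
  rw [← Φ.C_apply, Φ.C_G]

/-- The spray is horizontal: yᵏ Nᵐ_k = 2Gᵐ by Euler's theorem. -/
theorem sum_y_hor (a : A) : ∑ k, Φ.y k * Φ.hor k a = Φ.S a := by
  simp only [hor, mul_sub, Finset.sum_sub_distrib, Φ.S_apply]
  congr 1
  simp only [← Φ.sum_y_Y_G, Finset.mul_sum, Finset.sum_mul]
  rw [Finset.sum_comm]
  exact Finset.sum_congr rfl fun i _ => Finset.sum_congr rfl fun m _ => by ring

theorem C_Y_traceN (m : Fin n) : Φ.C (Φ.Y m Φ.traceN) = 0 := by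
  have := Φ.Y_C m Φ.traceN
  rw [Φ.C_traceN] at this
  linear_combination -this

/-- The trace has degree one in y, so its vertical derivatives have degree zero and the connection
terms cancel. -/
theorem sum_y_hor_Y_traceN (j : Fin n) :
    ∑ k, Φ.y k * Φ.hor j (Φ.Y k Φ.traceN) = Φ.X j Φ.traceN := by
  simp only [hor, mul_sub, Finset.sum_sub_distrib]
  have h1 : ∑ k, Φ.y k * Φ.X j (Φ.Y k Φ.traceN) = Φ.X j Φ.traceN := by
    conv_rhs => rw [← Φ.C_traceN, Φ.X_C, Φ.C_apply]
    exact Finset.sum_congr rfl fun k _ => by rw [Φ.Y_X]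
  have h2 : ∑ k, Φ.y k * ∑ m, Φ.Y j (Φ.G m) * Φ.Y m (Φ.Y k Φ.traceN) = 0 := by
    have : ∑ k, Φ.y k * ∑ m, Φ.Y j (Φ.G m) * Φ.Y m (Φ.Y k Φ.traceN) =
        ∑ m, Φ.Y j (Φ.G m) * Φ.C (Φ.Y m Φ.traceN) := by
      simp only [Φ.C_apply, Finset.mul_sum]
      rw [Finset.sum_comm]
      exact Finset.sum_congr rfl fun i _ => Finset.sum_congr rfl fun k _ => by
        rw [Φ.Y_Y i k]; ring
    rw [this]
    exact Finset.sum_eq_zero fun m _ => by rw [C_Y_traceN, mul_zero]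
  rw [h1, h2, sub_zero]

/-- Vanishing `χ`-curvature is the Euler-Lagrange equation for the trace of the nonlinear
connection. -/
theorem S_Y_traceN {j : Fin n} (h : ∑ i, ∑ k, Φ.Y i (Φ.curv i j k) * Φ.y k = 0) :
    Φ.S (Φ.Y j Φ.traceN) = Φ.X j Φ.traceN := by
  rw [Finset.sum_comm] at h
  simp only [← Finset.sum_mul, sum_Y_curv] at h
  rw [← Φ.sum_y_hor_Y_traceN, ← Φ.sum_y_hor, ← sub_eq_zero, ← Finset.sum_sub_distrib, ← h]
  exact Finset.sum_congr rfl fun k _ => by ring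

/-! ### Scalar mean Berwald curvature -/

variable {f : A}

/-- The trace of the connection and F both satisfy the hypothesis of `spray_hessian`. Inserting
τ_{ij} = f F_{ij} in the law for τ and subtracting f times the law for F leaves S(f) F_{ij} = 0;
then take the trace, which is nonzero as n ≥ 2. -/
theorem S_eq_zero_of_hess (hn : 2 ≤ n) (hχ : ∀ j, Φ.S (Φ.Y j Φ.traceN) = Φ.X j Φ.traceN)
    (hf : ∀ i j, Φ.Y i (Φ.Y j Φ.traceN) = f * Φ.Y i (Φ.Y j Φ.F)) : Φ.S f = 0 := by
  have h : ∀ i j, Φ.S f * Φ.Y i (Φ.Y j Φ.F) = 0 := fun i j => by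
    have h1 : Φ.S (Φ.Y i (Φ.Y j Φ.traceN)) = _ := Φ.spray_hessian Φ.G hχ i j
    have h2 : Φ.S (Φ.Y i (Φ.Y j Φ.F)) = _ := Φ.spray_hessian Φ.G Φ.S_Y_F i j
    simp only [hf, derivation_mul] at h1
    rw [h2, mul_add, Finset.mul_sum, Finset.mul_sum] at h1
    have h3 : ∀ j k, ∑ m, Φ.Y k (Φ.G m) * (f * Φ.Y m (Φ.Y j Φ.F)) =
        ∑ m, f * (Φ.Y k (Φ.G m) * Φ.Y m (Φ.Y j Φ.F)) := fun j k =>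
      Finset.sum_congr rfl fun m _ => by ring
    rw [h3, h3] at h1
    linear_combination h1
  have h4 : Φ.S f * ((n : A) - 1) = 0 := by
    rw [← Φ.sum_ginv_hess_F, ← mul_assoc, mul_comm (Φ.S f), mul_assoc, Finset.mul_sum]
    have : ∀ i, Φ.S f * ∑ j, Φ.ginv i j * Φ.Y i (Φ.Y j Φ.F) = 0 := fun i => by
      rw [Finset.mul_sum]
      exact Finset.sum_eq_zero fun j _ => by rw [mul_left_comm, h, mul_zero]
    simp [this]
  apply natCast_cancel (m := n - 1) (by omega)
  rw [Nat.cast_sub (by omega)]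
  linear_combination h4

/-- Third vertical derivatives of τ are symmetric, so f_k F_{ij} = f_j F_{ik}. Contracting with F
g^{ij} gives (n - 1) f_k on the left. On the right F F_{ik} = g_{ik} - F_i F_k gives f_k minus a
multiple of yʲ f_j = 0. Hence (n - 2) f_k = 0. -/
theorem Y_eq_zero_of_hess (hn : 2 < n) (hC : Φ.C f = 0)
    (hf : ∀ i j, Φ.Y i (Φ.Y j Φ.traceN) = f * Φ.Y i (Φ.Y j Φ.F)) (k : Fin n) : Φ.Y k f = 0 := by
  have h1 : ∀ i j, Φ.Y k f * Φ.Y i (Φ.Y j Φ.F) = Φ.Y j f * Φ.Y i (Φ.Y k Φ.F) := fun i j => by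
    have e1 := congrArg (Φ.Y k) (hf i j)
    have e2 := congrArg (Φ.Y j) (hf i k)
    rw [derivation_mul] at e1 e2
    rw [Φ.Y_Y k i, Φ.Y_Y k j, Φ.Y_Y k i, Φ.Y_Y k j] at e1
    rw [Φ.Y_Y j i] at e2
    rw [Φ.Y_Y j i (Φ.Y k Φ.F)] at e2
    linear_combination e2 - e1
  have h2 : Φ.Y k f * ((n : A) - 1) = ∑ i, ∑ j, Φ.ginv i j * (Φ.Y j f * (Φ.F * Φ.Y i (Φ.Y k Φ.F))) := by
    rw [← Φ.sum_ginv_hess_F, ← mul_assoc, Finset.mul_sum]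
    refine Finset.sum_congr rfl fun i _ => ?_
    rw [Finset.mul_sum]
    refine Finset.sum_congr rfl fun j _ => ?_
    linear_combination Φ.F * Φ.ginv i j * h1 i j
  have h3 : ∑ i, ∑ j, Φ.ginv i j * (Φ.Y j f * Φ.g i k) = Φ.Y k f := by
    rw [Finset.sum_comm]
    have : ∀ j, ∑ i, Φ.ginv i j * (Φ.Y j f * Φ.g i k) =
        Φ.Y j f * (1 : Matrix (Fin n) (Fin n) A) j k := fun j => by
      rw [← Φ.ginv_mul, Matrix.mul_apply, Finset.mul_sum]
      exact Finset.sum_congr rfl fun i _ => by rw [Φ.ginv_symm i j]; ring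
    simp [this, Matrix.one_apply]
  have h4 : Φ.F * ∑ i, ∑ j, Φ.ginv i j * (Φ.Y j f * (Φ.Y i Φ.F * Φ.Y k Φ.F)) = 0 := by
    rw [Finset.sum_comm, Finset.mul_sum]
    have : ∀ j, Φ.F * ∑ i, Φ.ginv i j * (Φ.Y j f * (Φ.Y i Φ.F * Φ.Y k Φ.F)) =
        Φ.y j * Φ.Y j f * Φ.Y k Φ.F := fun j => by
      rw [← Φ.sum_ginv_Y_F j, Finset.mul_sum, Finset.mul_sum, Finset.sum_mul, Finset.sum_mul]
      exact Finset.sum_congr rfl fun i _ => by rw [Φ.ginv_symm i j]; ring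
    simp only [this, ← Finset.sum_mul]
    rw [← Φ.C_apply, hC, zero_mul]
  have h5 : ∑ i, ∑ j, Φ.ginv i j * (Φ.Y j f * (Φ.F * Φ.Y i (Φ.Y k Φ.F))) =
      ∑ i, ∑ j, Φ.ginv i j * (Φ.Y j f * Φ.g i k) -
        ∑ i, ∑ j, Φ.ginv i j * (Φ.Y j f * (Φ.Y i Φ.F * Φ.Y k Φ.F)) := by
    simp only [← Finset.sum_sub_distrib]
    exact Finset.sum_congr rfl fun i _ => Finset.sum_congr rfl fun j _ => by
      rw [Φ.g_eq]; ring
  have h6 : ∑ i, ∑ j, Φ.ginv i j * (Φ.Y j f * (Φ.Y i Φ.F * Φ.Y k Φ.F)) = 0 :=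
    Φ.F_cancel (by rw [h4, mul_zero])
  rw [h5, h3, h6] at h2
  apply natCast_cancel (m := n - 2) (by omega)
  rw [Nat.cast_sub (by omega)]
  push_cast
  linear_combination h2

/-- With S(f) = 0 and all vertical derivatives zero, ∂f/∂xᵏ is the only term left in the commutator
of ∂/∂yᵏ with S. -/
theorem X_eq_zero_of_S (hS : Φ.S f = 0) (hY : ∀ k, Φ.Y k f = 0) (k : Fin n) : Φ.X k f = 0 := by
  have h : Φ.Y k (Φ.S f) = _ := Φ.Y_spray Φ.G k f
  simpa [hS, hY] using h.symm

end FinslerAlgebra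

end Finsler
end

noncomputable section

namespace Finsler

/-! ### Liouville's theorem -/

namespace FinslerAlgebra

variable {n : ℕ} {A : Type*} [CommRing A] [Algebra ℝ A] (Φ : FinslerAlgebra n A)

theorem S_g (i j : Fin n) : Φ.S (Φ.g i j) =
    ∑ m, Φ.Y j (Φ.G m) * Φ.g m i + ∑ m, Φ.Y i (Φ.G m) * Φ.g m j := by
  have h : Φ.S (Φ.Y i (Φ.Y j (Φ.F * Φ.F))) = _ := Φ.spray_hessian Φ.G Φ.spray_Y_FF i j
  have h1 : ∀ i j, Φ.Y i (Φ.Y j (Φ.F * Φ.F)) = 2 * Φ.g i j := fun i j => by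
    rw [Φ.two_g, Φ.Y_Y]
  simp only [h1] at h
  rw [two_mul, map_add, ← two_mul] at h
  apply two_cancel
  rw [h, mul_add, Finset.mul_sum, Finset.mul_sum]
  congr 1 <;> exact Finset.sum_congr rfl fun m _ => by ring

/-- Jacobi's formula applied to `S_g`: each of the two connection terms contributes one trace of N.
-/
theorem S_det : Φ.S Φ.g.det = 2 * Φ.traceN * Φ.g.det := by
  rw [derivation_det Φ.S _ _ Φ.ginv_mul]
  have h1 : ∀ k l, ∑ m, Φ.ginv k m * Φ.g m l = (1 : Matrix (Fin n) (Fin n) A) k l := fun k l => by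
    rw [← Φ.ginv_mul, Matrix.mul_apply]
  have h2 : ∑ i, ∑ j, Φ.ginv i j * ∑ m, Φ.Y i (Φ.G m) * Φ.g m j = Φ.traceN := by
    rw [traceN]
    refine Finset.sum_congr rfl fun i _ => ?_
    simp only [Finset.mul_sum]
    rw [Finset.sum_comm]
    have : ∀ m, ∑ j, Φ.ginv i j * (Φ.Y i (Φ.G m) * Φ.g m j) =
        Φ.Y i (Φ.G m) * (1 : Matrix (Fin n) (Fin n) A) i m := fun m => by
      rw [← h1, Finset.mul_sum]
      exact Finset.sum_congr rfl fun j _ => by rw [Φ.g_symm m j]; ring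
    simp [this, Matrix.one_apply]
  have h3 : ∑ i, ∑ j, Φ.ginv i j * ∑ m, Φ.Y j (Φ.G m) * Φ.g m i = Φ.traceN := by
    rw [← h2, Finset.sum_comm]
    exact Finset.sum_congr rfl fun i _ => Finset.sum_congr rfl fun j _ => by rw [Φ.ginv_symm]
  have h4 : ∑ i, ∑ j, Φ.ginv i j * Φ.S (Φ.g j i) = Φ.traceN + Φ.traceN := by
    have h5 : ∑ i, ∑ j, Φ.ginv i j * Φ.S (Φ.g j i) =
        ∑ i, ∑ j, Φ.ginv i j * ∑ m, Φ.Y i (Φ.G m) * Φ.g m j +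
          ∑ i, ∑ j, Φ.ginv i j * ∑ m, Φ.Y j (Φ.G m) * Φ.g m i := by
      simp only [← Finset.sum_add_distrib]
      refine Finset.sum_congr rfl fun i _ => Finset.sum_congr rfl fun j _ => ?_
      rw [S_g]; ring
    rw [h5, h2, h3]
  rw [h4]; ring

theorem Y_g_symm (i j k : Fin n) : Φ.Y i (Φ.g j k) = Φ.Y j (Φ.g i k) := by
  apply two_cancel
  rw [← Φ.Y_two_mul, ← Φ.Y_two_mul, Φ.two_g, Φ.two_g, Φ.Y_Y i k, Φ.Y_Y i j, Φ.Y_Y k j]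

/-- The field det(g) g^{jk} is divergence free on each fibre. Differentiating the determinant and
the inverse gives two contractions of ∂g/∂y, which agree because that tensor is totally symmetric
(`Y_g_symm`). -/
theorem sum_Y_ginv_mul_det (k : Fin n) : ∑ j, (Φ.ginv j k * Φ.Y j Φ.g.det +
    Φ.g.det * Φ.Y j (Φ.ginv j k)) = 0 := by
  have h1 : ∑ j, Φ.ginv j k * Φ.Y j Φ.g.det =
      Φ.g.det * ∑ j, ∑ a, ∑ b, Φ.ginv j k * (Φ.ginv a b * Φ.Y j (Φ.g b a)) := by
    simp only [Finset.mul_sum]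
    refine Finset.sum_congr rfl fun j _ => ?_
    rw [derivation_det (Φ.Y j) _ _ Φ.ginv_mul]
    simp only [Finset.mul_sum]
    exact Finset.sum_congr rfl fun a _ => Finset.sum_congr rfl fun b _ => by ring
  have h2 : ∑ j, Φ.g.det * Φ.Y j (Φ.ginv j k) =
      -(Φ.g.det * ∑ b, ∑ j, ∑ a, Φ.ginv j a * Φ.Y j (Φ.g a b) * Φ.ginv b k) := by
    rw [← Finset.mul_sum, ← mul_neg, ← Finset.sum_neg_distrib]
    simp only [derivation_inv _ _ _ Φ.ginv_mul, Finset.sum_neg_distrib]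
    congr 2
    rw [Finset.sum_comm (f := fun b j => ∑ a, Φ.ginv j a * Φ.Y j (Φ.g a b) * Φ.ginv b k)]
    exact Finset.sum_congr rfl fun j _ => Finset.sum_comm
  rw [Finset.sum_add_distrib, h1, h2]
  have h3 : ∑ j, ∑ a, ∑ b, Φ.ginv j k * (Φ.ginv a b * Φ.Y j (Φ.g b a)) =
      ∑ b, ∑ j, ∑ a, Φ.ginv j a * Φ.Y j (Φ.g a b) * Φ.ginv b k := by
    refine Finset.sum_congr rfl fun j _ => Finset.sum_congr rfl fun a _ =>
      Finset.sum_congr rfl fun b _ => ?_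
    rw [Φ.Y_g_symm j b a, Φ.g_symm j a, Φ.Y_g_symm b a j, Φ.g_symm b j]; ring
  rw [h3]; ring

/-- A density for the Liouville measure together with a primitive of the trace of the connection
along the spray: `W = |det g|` and `L = ½ log |det g|`. -/
structure IsLiouville (W L : A) : Prop where
  W_sq : W * W = Φ.g.det * Φ.g.det
  X_L : ∀ k, 2 * Φ.g.det * Φ.X k L = Φ.X k Φ.g.det
  Y_L : ∀ k, 2 * Φ.g.det * Φ.Y k L = Φ.Y k Φ.g.det

variable {Φ} {W L : A}

theorem det_cancel {a b : A} (h : Φ.g.det * a = Φ.g.det * b) : a = b := by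
  have h1 : Φ.ginv.det * Φ.g.det = 1 := by rw [← Matrix.det_mul, Φ.ginv_mul, Matrix.det_one]
  linear_combination Φ.ginv.det * h + (b - a) * h1

/-- From W² = det², W and det g have the same logarithmic derivatives, so identities for det g
transfer to |det g|. -/
theorem IsLiouville.det_mul (h : Φ.IsLiouville W L) (D : Derivation ℝ A A) :
    Φ.g.det * D W = W * D Φ.g.det := by
  have h1 := congrArg D h.W_sq
  rw [derivation_mul, derivation_mul] at h1
  apply det_cancel (Φ := Φ)
  apply two_cancel
  linear_combination W * h1 - 2 * D W * h.W_sq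

theorem IsLiouville.S_W (h : Φ.IsLiouville W L) : Φ.S W = 2 * Φ.traceN * W := by
  apply det_cancel (Φ := Φ)
  rw [h.det_mul, S_det]; ring

theorem IsLiouville.S_L (h : Φ.IsLiouville W L) : Φ.S L = Φ.traceN := by
  apply det_cancel (Φ := Φ)
  apply two_cancel
  have h1 : 2 * (Φ.g.det * Φ.S L) = Φ.S Φ.g.det := by
    simp only [S_apply, mul_sub, Finset.mul_sum]
    congr 1
    · exact Finset.sum_congr rfl fun k _ => by rw [← h.X_L]; ring
    · exact Finset.sum_congr rfl fun k _ => by rw [← h.Y_L]; ring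
  rw [h1, S_det]; ring

theorem IsLiouville.sum_Y (h : Φ.IsLiouville W L) (k : Fin n) :
    ∑ j, Φ.Y j (Φ.ginv j k * W) = 0 := by
  apply det_cancel (Φ := Φ)
  rw [mul_zero]
  have h1 := congrArg (W * ·) (Φ.sum_Y_ginv_mul_det k)
  simp only [mul_zero] at h1
  rw [← h1, Finset.mul_sum, Finset.mul_sum]
  refine Finset.sum_congr rfl fun j _ => ?_
  rw [derivation_mul]
  linear_combination Φ.ginv j k * h.det_mul (Φ.Y j)

theorem C_g (i j : Fin n) : Φ.C (Φ.g i j) = 0 := by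
  rw [Φ.g_eq, map_add, derivation_mul, derivation_mul, Φ.C_Y_F, Φ.C_Y_F, Φ.C_F]
  have := Φ.Y_C i (Φ.Y j Φ.F)
  rw [Φ.C_Y_F, map_zero] at this
  linear_combination -Φ.F * this

theorem IsLiouville.C_W (h : Φ.IsLiouville W L) : Φ.C W = 0 := by
  apply det_cancel (Φ := Φ)
  rw [h.det_mul, derivation_det _ _ _ Φ.ginv_mul]
  simp [C_g]

/-! ### Integration -/

/-- An ideal `K` of "compactly supported" functions and a functional `I` on it which vanishes on
derivatives. -/
structure Stokes (J : PhaseAlgebra n A) (K : Ideal A) (I : A → ℝ) : Prop where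
  X_mem : ∀ k, ∀ a ∈ K, J.X k a ∈ K
  Y_mem : ∀ k, ∀ a ∈ K, J.Y k a ∈ K
  add : ∀ a ∈ K, ∀ b ∈ K, I (a + b) = I a + I b
  X_eq : ∀ k, ∀ a ∈ K, I (J.X k a) = 0
  Y_eq : ∀ k, ∀ a ∈ K, I (J.Y k a) = 0

/-- `θ₀ = θ(F²/2)` and `θ₁ = θ'(F²/2)`. -/
structure IsCutoff (Φ : FinslerAlgebra n A) (θ₀ θ₁ θ₂ : A) : Prop where
  Y_zero : ∀ k, Φ.Y k θ₀ = θ₁ * (Φ.F * Φ.Y k Φ.F)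
  X_one : ∀ k, Φ.X k θ₁ = θ₂ * (Φ.F * Φ.X k Φ.F)
  Y_one : ∀ k, Φ.Y k θ₁ = θ₂ * (Φ.F * Φ.Y k Φ.F)

namespace Stokes

variable {K : Ideal A} {I : A → ℝ}

section

variable {J : PhaseAlgebra n A} (h : Stokes J K I)
include h

theorem zero : I 0 = 0 := by
  have := h.add 0 K.zero_mem 0 K.zero_mem
  rw [add_zero] at this
  linarith

theorem sum {ι : Type*} (s : Finset ι) {a : ι → A} (ha : ∀ i ∈ s, a i ∈ K) :
    I (∑ i ∈ s, a i) = ∑ i ∈ s, I (a i) := by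
  classical
  induction s using Finset.induction_on with
  | empty => simp [h.zero]
  | insert i s hi ih =>
    rw [Finset.sum_insert hi, Finset.sum_insert hi,
      h.add _ (ha _ (Finset.mem_insert_self _ _)) _
        (K.sum_mem fun j hj => ha j (Finset.mem_insert_of_mem hj)),
      ih fun j hj => ha j (Finset.mem_insert_of_mem hj)]

theorem neg {a : A} (ha : a ∈ K) : I (-a) = -I a := by
  have := h.add a ha (-a) (K.neg_mem ha)
  rw [add_neg_cancel, h.zero] at this
  linarith

theorem sub {a b : A} (ha : a ∈ K) (hb : b ∈ K) : I (a - b) = I a - I b := by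
  rw [sub_eq_add_neg, h.add _ ha _ (K.neg_mem hb), h.neg hb, sub_eq_add_neg]

theorem natCast_mul (m : ℕ) {a : A} (ha : a ∈ K) : I (m * a) = m * I a := by
  induction m with
  | zero => simp [h.zero]
  | succ m ih =>
    push_cast
    rw [add_mul, h.add _ (K.mul_mem_left _ ha) _ (K.mul_mem_left _ ha), ih, one_mul]
    ring

theorem sum_Y {v : Fin n → A} (hv : ∀ k, v k ∈ K) : I (∑ k, J.Y k (v k)) = 0 := by
  rw [h.sum _ fun k _ => h.Y_mem k _ (hv k)]
  exact Finset.sum_eq_zero fun k _ => h.Y_eq k _ (hv k)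

theorem sum_X {v : Fin n → A} (hv : ∀ k, v k ∈ K) : I (∑ k, J.X k (v k)) = 0 := by
  rw [h.sum _ fun k _ => h.X_mem k _ (hv k)]
  exact Finset.sum_eq_zero fun k _ => h.X_eq k _ (hv k)

end

variable {θ₀ θ₁ θ₂ : A} (h : Stokes Φ.toPhaseAlgebra K I)
include h

/-- The integrand is the divergence of the vertical field with components a yᵏ. -/
theorem C {a : A} (ha : a ∈ K) : I (n * a + Φ.C a) = 0 := by
  rw [← h.sum_Y (v := fun k => Φ.y k * a) fun k => K.mul_mem_left _ ha]
  congr 1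
  simp only [derivation_mul, Φ.Y_y, if_true, Finset.sum_add_distrib, Φ.C_apply]
  simp [add_comm]

/-- The integrand is the divergence of a times the spray, the spray having divergence -2τ for dx dy.
Together with S(W) = 2τW this is the invariance of W dx dy. -/
theorem spray {a : A} (ha : a ∈ K) : I (Φ.S a - 2 * Φ.traceN * a) = 0 := by
  have h1 := h.sum_X (v := fun k => Φ.y k * a) fun k => K.mul_mem_left _ ha
  have h2 := h.sum_Y (v := fun k => 2 * Φ.G k * a) fun k => K.mul_mem_left _ ha
  have h3 : Φ.S a - 2 * Φ.traceN * a =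
      ∑ k, Φ.X k (Φ.y k * a) - ∑ k, Φ.Y k (2 * Φ.G k * a) := by
    simp only [derivation_mul _ (Φ.y _), derivation_mul _ (2 * Φ.G _), Φ.X_y, mul_zero, add_zero,
      Finset.sum_add_distrib, Φ.Y_two_mul, S_apply, traceN, Finset.mul_sum, Finset.sum_mul]
    have : ∑ i, a * (2 * Φ.Y i (Φ.G i)) = ∑ i, 2 * Φ.Y i (Φ.G i) * a :=
      Finset.sum_congr rfl fun i _ => by ring
    rw [this]; ring
  rw [h3, h.sub (K.sum_mem fun k _ => h.X_mem k _ (K.mul_mem_left _ ha))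
    (K.sum_mem fun k _ => h.Y_mem k _ (K.mul_mem_left _ ha)), h1, h2, sub_zero]

variable (hW : Φ.IsLiouville W L) (hθ : IsCutoff Φ θ₀ θ₁ θ₂)
include hW hθ

omit h hW in
-- A function of F is a first integral. The element `θ₂` plays the role of θ''(F²/2).
theorem S_cutoff : Φ.S θ₁ = 0 := by
  have : Φ.S θ₁ = θ₂ * (Φ.F * Φ.S Φ.F) := by
    simp only [S_apply, hθ.X_one, hθ.Y_one, mul_sub, Finset.mul_sum]
    congr 1 <;> exact Finset.sum_congr rfl fun k _ => by ring
  rw [this, Φ.S_F]; ring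

/-- Integration by parts along the spray, which preserves the density W and the cutoff: S moves from
q to L, and S(L) = τ. -/
theorem spray_log {q : A} (hq : q * θ₁ ∈ K) (hSq : Φ.S q * θ₁ ∈ K) :
    I (Φ.S q * θ₁ * L * W) = -I (q * θ₁ * Φ.traceN * W) := by
  have h1 := h.spray (a := q * θ₁ * (L * W)) (K.mul_mem_right _ hq)
  have h2 : Φ.S (q * θ₁ * (L * W)) - 2 * Φ.traceN * (q * θ₁ * (L * W)) =
      Φ.S q * θ₁ * L * W + q * θ₁ * Φ.traceN * W := by
    rw [derivation_mul, derivation_mul, derivation_mul, S_cutoff hθ, hW.S_W, hW.S_L]; ring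
  rw [h2, h.add _ (K.mul_mem_right _ (K.mul_mem_right _ hSq)) _
    (K.mul_mem_right _ (K.mul_mem_right _ hq))] at h1
  linarith

/-- The integral over the fibres of a fibrewise linear function vanishes. -/
theorem linear {b : Fin n → A} (hb : ∀ k, b k * θ₀ ∈ K) (hYb : ∀ j k, Φ.Y j (b k) = 0) :
    I ((∑ k, b k * Φ.y k) * θ₁ * W) = 0 := by
  have h1 : ∀ j, ∑ k, b k * θ₀ * (Φ.ginv j k * W) ∈ K := fun j =>
    K.sum_mem fun k _ => K.mul_mem_right _ (hb k)
  have h2 := h.sum_Y h1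
  rw [← h2]
  congr 1
  simp only [map_sum]
  rw [Finset.sum_comm, Finset.sum_mul, Finset.sum_mul]
  refine Finset.sum_congr rfl fun k _ => ?_
  -- For each k, yᵏ θ₁ W is the fibrewise divergence of θ₀ g^{jk} W: the field g^{jk} W is
  -- divergence free, and F g^{jk} F_j = yᵏ. The coefficients b_k do not depend on y.
  have h3 : ∀ j, Φ.Y j (b k * θ₀ * (Φ.ginv j k * W)) =
      b k * θ₀ * Φ.Y j (Φ.ginv j k * W) +
        b k * θ₁ * W * (Φ.F * (Φ.ginv k j * Φ.Y j Φ.F)) := fun j => by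
    rw [derivation_mul, derivation_mul (Φ.Y j) (b k), hYb, hθ.Y_zero, Φ.ginv_symm k j]; ring
  simp only [h3, Finset.sum_add_distrib, ← Finset.mul_sum]
  rw [hW.sum_Y, Φ.sum_ginv_Y_F]; ring

/-- Apply the divergence formula for the Liouville field to a = q θ₀ F⁻¹ W. Since q and W have
degree 0 and F⁻¹ has degree -1, C(a) = q θ₁ F W - a, so n a + C(a) = q θ₁ F W + (n - 1) a. -/
theorem homogeneous {q : A} (hq : q * θ₀ ∈ K) (hq1 : q * θ₁ ∈ K) (hYq : ∀ j, Φ.Y j q = 0) :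
    I (q * θ₁ * Φ.F * W) = -((n - 1 : ℝ) * I (q * θ₀ * Φ.Finv * W)) := by
  have hFinv : Φ.C Φ.Finv = -Φ.Finv := by
    have h1 := congrArg Φ.C Φ.F_inv
    rw [derivation_mul, Φ.C_F, Derivation.map_one_eq_zero] at h1
    apply Φ.F_cancel
    linear_combination h1
  have hm : q * θ₀ * Φ.Finv * W ∈ K := K.mul_mem_right _ (K.mul_mem_right _ hq)
  have hm1 : q * θ₁ * Φ.F * W ∈ K := K.mul_mem_right _ (K.mul_mem_right _ hq1)
  have h1 := h.C hm
  have h2 : Φ.C (q * θ₀ * Φ.Finv * W) = q * θ₁ * Φ.F * W - q * θ₀ * Φ.Finv * W := by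
    have hCq : Φ.C q = 0 := by simp [Φ.C_apply, hYq]
    have hCθ : Φ.C θ₀ = θ₁ * (Φ.F * Φ.F) := by
      simp only [Φ.C_apply, hθ.Y_zero]
      conv_rhs => rw [← Φ.C_F, Φ.C_apply]
      simp only [Φ.euler]
      rw [← Φ.C_F, Φ.C_apply, Finset.mul_sum, Finset.mul_sum]
      simp only [Φ.euler]
      exact Finset.sum_congr rfl fun k _ => by ring
    rw [derivation_mul, derivation_mul, derivation_mul, hW.C_W, hFinv, hCq, hCθ]
    linear_combination q * θ₁ * Φ.F * W * Φ.F_inv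
  rw [h2, h.add _ (K.mul_mem_left _ hm) _ (K.sub_mem hm1 hm), h.sub hm1 hm,
    h.natCast_mul n hm] at h1
  linarith

/-- Integration of the `S`-curvature against a cutoff, for scalar mean Berwald curvature which is a
constant `f`. -/
theorem scalar {f ρ : A} (hX : ∀ k, Φ.X k f = 0) (hY : ∀ k, Φ.Y k f = 0)
    (hf : ∀ i j, Φ.Y i (Φ.Y j Φ.traceN) = f * Φ.Y i (Φ.Y j Φ.F))
    (hρ0 : ρ * θ₀ ∈ K) (hρ1 : ρ * θ₁ ∈ K) (hSρ : Φ.S ρ * θ₁ ∈ K) (hYρ : ∀ k, Φ.Y k ρ = 0) :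
    I (f * Φ.S ρ * θ₁ * L * W) = (n - 1 : ℝ) * I (f * f * ρ * θ₀ * Φ.Finv * W) := by
  have hS : Φ.S f = 0 := by simp [S_apply, hX, hY]
  have m : ∀ {a : A} (b : A), a ∈ K → b * a ∈ K := fun b ha => K.mul_mem_left b ha
  have hSq : Φ.S (f * ρ) = f * Φ.S ρ := by rw [derivation_mul, hS]; ring
  have h1 := h.spray_log hW hθ (q := f * ρ) (by rw [mul_assoc]; exact m _ hρ1)
    (by rw [hSq, mul_assoc]; exact m _ hSρ)
  rw [hSq] at h1
  -- Both τ and fF have degree one in y and they have the same vertical Hessian. Hence τ - fF equals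
  -- a_k yᵏ with a_k independent of y.
  set a : Fin n → A := fun k => Φ.Y k Φ.traceN - f * Φ.Y k Φ.F with ha
  have hP : Φ.traceN = f * Φ.F + ∑ k, a k * Φ.y k := by
    have e1 := Φ.C_traceN
    have e2 := Φ.C_F
    rw [Φ.C_apply] at e1 e2
    conv_lhs => rw [← e1]
    conv_rhs => enter [1, 2]; rw [← e2]
    rw [Finset.mul_sum, ← Finset.sum_add_distrib]
    exact Finset.sum_congr rfl fun k _ => by simp only [ha]; ring
  have h2 : f * ρ * θ₁ * Φ.traceN * W =
      f * f * ρ * θ₁ * Φ.F * W + (∑ k, f * ρ * a k * Φ.y k) * θ₁ * W := by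
    have : ∑ k, f * ρ * a k * Φ.y k = f * ρ * ∑ k, a k * Φ.y k := by
      rw [Finset.mul_sum]; exact Finset.sum_congr rfl fun k _ => by ring
    rw [this]
    linear_combination f * ρ * θ₁ * W * hP
  have h3 := h.linear hW hθ (b := fun k => f * ρ * a k)
    (fun k => by
      have : f * ρ * a k * θ₀ = f * a k * (ρ * θ₀) := by ring
      rw [this]; exact m _ hρ0)
    (fun j k => by
      simp only [derivation_mul, hY, hYρ, ha, map_sub, hf]; ring)
  have h4 := h.homogeneous hW hθ (q := f * f * ρ) (by rw [mul_assoc]; exact m _ hρ0)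
    (by rw [mul_assoc]; exact m _ hρ1) (fun j => by simp only [derivation_mul, hY, hYρ]; ring)
  have m1 : f * f * ρ * θ₁ * Φ.F * W ∈ K := by
    have : f * f * ρ * θ₁ * Φ.F * W = f * f * Φ.F * W * (ρ * θ₁) := by ring
    rw [this]; exact m _ hρ1
  have m2 : (∑ k, f * ρ * a k * Φ.y k) * θ₁ * W ∈ K := by
    rw [Finset.sum_mul, Finset.sum_mul]
    refine K.sum_mem fun k _ => ?_
    have : f * ρ * a k * Φ.y k * θ₁ * W = f * a k * Φ.y k * W * (ρ * θ₁) := by ring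
    rw [this]; exact m _ hρ1
  rw [h1, h2, h.add _ m1 _ m2, h3, h4]; ring

end Stokes

end FinslerAlgebra

end Finsler
end

noncomputable section

namespace Finsler

open TopologicalSpace

/-! ### Smooth functions on an open set of phase space -/

variable {n : ℕ}

/-- The algebra of smooth functions on `U`. -/
def smoothAlgebra (U : Opens (Model n × Model n)) : Subalgebra ℝ (U → ℝ) where
  carrier := {a | ∃ φ : Model n × Model n → ℝ, ContDiffOn ℝ ∞ φ U ∧ ∀ z : U, a z = φ z}
  mul_mem' := by
    rintro a b ⟨φ, hφ, ha⟩ ⟨ψ, hψ, hb⟩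
    exact ⟨fun z => φ z * ψ z, hφ.mul hψ, fun z => by simp [ha, hb]⟩
  add_mem' := by
    rintro a b ⟨φ, hφ, ha⟩ ⟨ψ, hψ, hb⟩
    exact ⟨fun z => φ z + ψ z, hφ.add hψ, fun z => by simp [ha, hb]⟩
  algebraMap_mem' r := ⟨fun _ => r, contDiffOn_const, fun _ => rfl⟩

variable {U : Opens (Model n × Model n)}

/-- Evaluation at a point of `U`. -/
def ev (z : U) : smoothAlgebra U →ₐ[ℝ] ℝ :=
  (Pi.evalAlgHom ℝ (fun _ : U => ℝ) z).comp (smoothAlgebra U).val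

theorem ev_ext {a b : smoothAlgebra U} (h : ∀ z, ev z a = ev z b) : a = b :=
  Subtype.ext (funext h)

/-- The function `φ` restricts to the element `a` of the algebra of smooth functions on `U`. -/
def Rep (φ : Model n × Model n → ℝ) (a : smoothAlgebra U) : Prop := ∀ z : U, ev z a = φ z

/-- A smooth function as an element of the algebra of smooth functions. -/
def ofFun (φ : Model n × Model n → ℝ) (hφ : ContDiffOn ℝ ∞ φ U) : smoothAlgebra U :=
  ⟨fun z => φ z, φ, hφ, fun _ => rfl⟩

theorem rep_ofFun {φ : Model n × Model n → ℝ} (hφ : ContDiffOn ℝ ∞ φ U) : Rep φ (ofFun φ hφ) :=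
  fun _ => rfl

namespace Rep

variable {φ ψ : Model n × Model n → ℝ} {a b : smoothAlgebra U}

theorem exists_rep (a : smoothAlgebra U) : ∃ φ, ContDiffOn ℝ ∞ φ U ∧ Rep φ a := a.2

theorem contDiffOn (ha : Rep φ a) : ContDiffOn ℝ ∞ φ U := by
  obtain ⟨ψ, hψ, h⟩ := exists_rep a
  exact hψ.congr fun z hz => by rw [← ha ⟨z, hz⟩, h]

theorem contDiffAt (ha : Rep φ a) {z : Model n × Model n} (hz : z ∈ U) : ContDiffAt ℝ ∞ φ z :=
  ha.contDiffOn.contDiffAt (U.isOpen.mem_nhds hz)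

theorem differentiableAt (ha : Rep φ a) {z : Model n × Model n} (hz : z ∈ U) :
    DifferentiableAt ℝ φ z :=
  (ha.contDiffAt hz).differentiableAt (by simp)

theorem add (ha : Rep φ a) (hb : Rep ψ b) : Rep (fun z => φ z + ψ z) (a + b) := fun z => by
  rw [map_add, ha, hb]

theorem sub (ha : Rep φ a) (hb : Rep ψ b) : Rep (fun z => φ z - ψ z) (a - b) := fun z => by
  rw [map_sub, ha, hb]

theorem mul (ha : Rep φ a) (hb : Rep ψ b) : Rep (fun z => φ z * ψ z) (a * b) := fun z => by
  rw [map_mul, ha, hb]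

theorem smul (c : ℝ) (ha : Rep φ a) : Rep (fun z => c * φ z) (c • a) := fun z => by
  rw [map_smul, ha, smul_eq_mul]

theorem sum {ι : Type*} {s : Finset ι} {φ : ι → Model n × Model n → ℝ} {a : ι → smoothAlgebra U}
    (h : ∀ i, Rep (φ i) (a i)) : Rep (fun z => ∑ i ∈ s, φ i z) (∑ i ∈ s, a i) := fun z => by
  rw [map_sum]; exact Finset.sum_congr rfl fun i _ => h i z

theorem congr (ha : Rep φ a) (h : ∀ z ∈ U, ψ z = φ z) : Rep ψ a := fun z => by
  rw [ha, h _ z.2]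

theorem eq_on (ha : Rep φ a) (hb : Rep ψ a) {z : Model n × Model n} (hz : z ∈ U) : φ z = ψ z := by
  rw [← ha ⟨z, hz⟩, ← hb ⟨z, hz⟩]

theorem fderiv_eq (ha : Rep φ a) (hb : Rep ψ a) {z : Model n × Model n} (hz : z ∈ U) :
    fderiv ℝ φ z = fderiv ℝ ψ z :=
  Filter.EventuallyEq.fderiv_eq
    (Filter.eventually_of_mem (U.isOpen.mem_nhds hz) fun _ hw => ha.eq_on hb hw)

theorem contDiffOn_fderiv (ha : Rep φ a) (v : Model n × Model n) :
    ContDiffOn ℝ ∞ (fun z => fderiv ℝ φ z v) U :=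
  (ha.contDiffOn.fderiv_of_isOpen U.isOpen (by simp)).clm_apply contDiffOn_const

theorem exists_comp (ha : Rep φ a) {h : ℝ → ℝ} (hh : ∀ z ∈ U, ContDiffAt ℝ ∞ h (φ z)) :
    ∃ b : smoothAlgebra U, Rep (fun z => h (φ z)) b :=
  ⟨ofFun _ fun z hz => ((hh z hz).comp z (ha.contDiffAt hz)).contDiffWithinAt, rep_ofFun _⟩

theorem exists_inv (ha : Rep φ a) (h : ∀ z ∈ U, φ z ≠ 0) : ∃ b : smoothAlgebra U, a * b = 1 := by
  obtain ⟨b, hb⟩ := ha.exists_comp (h := fun t => t⁻¹) fun z hz => contDiffAt_inv ℝ (h z hz)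
  exact ⟨b, ev_ext fun z => by rw [map_mul, ha, hb, map_one, mul_inv_cancel₀ (h z z.2)]⟩

end Rep

/-- The directional derivative. -/
def dir (v : Model n × Model n) : Derivation ℝ (smoothAlgebra U) (smoothAlgebra U) :=
  -- An element determines its representatives on the open set U only, which is enough to determine
  -- their derivatives there; the choice of representative is harmless.
  have key : ∀ a : smoothAlgebra U, Rep (fun z => fderiv ℝ (Rep.exists_rep a).choose z v)
      (ofFun _ ((Rep.exists_rep a).choose_spec.2.contDiffOn_fderiv v)) := fun a => rep_ofFun _
  Derivation.mk'
    { toFun := fun a => ofFun _ ((Rep.exists_rep a).choose_spec.2.contDiffOn_fderiv v)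
      map_add' := fun a b => ev_ext fun z => by
        have ha := (Rep.exists_rep a).choose_spec.2
        have hb := (Rep.exists_rep b).choose_spec.2
        rw [map_add, key, key, key]
        beta_reduce
        rw [(Rep.exists_rep (a + b)).choose_spec.2.fderiv_eq (ha.add hb) z.2,
          fderiv_fun_add (ha.differentiableAt z.2) (hb.differentiableAt z.2)]
        rfl
      map_smul' := fun c a => ev_ext fun z => by
        have ha := (Rep.exists_rep a).choose_spec.2
        rw [RingHom.id_apply, map_smul, key, key]
        beta_reduce
        rw [(Rep.exists_rep (c • a)).choose_spec.2.fderiv_eq (ha.smul c) z.2,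
          fderiv_const_mul (ha.differentiableAt z.2)]
        rfl }
    fun a b => ev_ext fun z => by
      have ha := (Rep.exists_rep a).choose_spec.2
      have hb := (Rep.exists_rep b).choose_spec.2
      simp only [smul_eq_mul, map_add, map_mul, LinearMap.coe_mk, AddHom.coe_mk]
      rw [key, key, key]
      beta_reduce
      rw [(Rep.exists_rep (a * b)).choose_spec.2.fderiv_eq (ha.mul hb) z.2,
        fderiv_fun_mul (ha.differentiableAt z.2) (hb.differentiableAt z.2), ha, hb]
      rfl

theorem Rep.dir {φ : Model n × Model n → ℝ} {a : smoothAlgebra U} (ha : Rep φ a)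
    (v : Model n × Model n) : Rep (fun z => fderiv ℝ φ z v) (dir v a) := fun z => by
  beta_reduce
  rw [ha.fderiv_eq (Rep.exists_rep a).choose_spec.2 z.2]
  rfl

theorem dir_comm (v w : Model n × Model n) (a : smoothAlgebra U) :
    dir v (dir w a) = dir w (dir v a) := by
  obtain ⟨φ, -, ha⟩ := Rep.exists_rep a
  refine ev_ext fun z => ?_
  rw [(ha.dir w).dir v, (ha.dir v).dir w]
  have hd : DifferentiableAt ℝ (fderiv ℝ φ) z :=
    ((ha.contDiffAt z.2).fderiv_right (m := 1) (by norm_cast)).differentiableAt (by simp)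
  have h : ∀ u : Model n × Model n, fderiv ℝ (fun z => fderiv ℝ φ z u) z =
      (fderiv ℝ (fderiv ℝ φ) z).flip u := fun u => by
    refine ContinuousLinearMap.ext fun t => ?_
    rw [fderiv_clm_apply hd (differentiableAt_const u)]
    simp
  beta_reduce
  rw [h, h]
  exact ((ha.contDiffAt z.2).isSymmSndFDerivAt
    (by rw [minSmoothness_of_isRCLikeNormedField]; exact WithTop.coe_le_coe.2 le_top)) v w

theorem dir_comp {φ : Model n × Model n → ℝ} {h h' : ℝ → ℝ} {a b c : smoothAlgebra U}
    (ha : Rep φ a) (hb : Rep (fun z => h (φ z)) b) (hc : Rep (fun z => h' (φ z)) c)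
    (hh : ∀ z ∈ U, HasDerivAt h (h' (φ z)) (φ z)) (v : Model n × Model n) :
    dir v b = c * dir v a := ev_ext fun z => by
  rw [map_mul, hb.dir v, ha.dir v, hc]
  have := ((hh z z.2).comp_hasFDerivAt z.1 (ha.differentiableAt z.2).hasFDerivAt).fderiv
  simp only [Function.comp_def] at this
  beta_reduce
  rw [this]
  simp

theorem contDiff_coord (k : Fin n) : ContDiff ℝ ∞ fun z : Model n × Model n => z.2 k :=
  (EuclideanSpace.proj (𝕜 := ℝ) k).contDiff.comp contDiff_snd

theorem fderiv_coord (k : Fin n) (z v : Model n × Model n) :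
    fderiv ℝ (fun z : Model n × Model n => z.2 k) z v = v.2 k := by
  have : HasFDerivAt (fun z : Model n × Model n => z.2 k)
      ((EuclideanSpace.proj (𝕜 := ℝ) k).comp (ContinuousLinearMap.snd ℝ _ _)) z :=
    (EuclideanSpace.proj (𝕜 := ℝ) k).hasFDerivAt.comp z hasFDerivAt_snd
  rw [this.fderiv]; rfl

/-- The coordinate `yᵏ`. -/
def coord (U : Opens (Model n × Model n)) (k : Fin n) : smoothAlgebra U :=
  ofFun (fun z => z.2 k) (contDiff_coord k).contDiffOn

theorem rep_coord (k : Fin n) : Rep (fun z => z.2 k) (coord U k) := rep_ofFun _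

/-- The coordinates and the partial derivatives on `U`. -/
def phaseAlgebra (U : Opens (Model n × Model n)) : PhaseAlgebra n (smoothAlgebra U) where
  X i := dir (EuclideanSpace.single i 1, 0)
  Y i := dir (0, EuclideanSpace.single i 1)
  y := coord U
  Y_X _ _ _ := dir_comm _ _ _
  Y_Y _ _ _ := dir_comm _ _ _
  X_y i j := ev_ext fun z => by
    rw [(rep_coord j).dir]
    beta_reduce
    rw [fderiv_coord]; simp
  Y_y i j := ev_ext fun z => by
    rw [(rep_coord j).dir]
    beta_reduce
    rw [fderiv_coord]
    simp only [PiLp.single_apply, eq_comm (a := j)]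
    split_ifs <;> simp

namespace Rep

variable {φ : Model n × Model n → ℝ} {a : smoothAlgebra U}

theorem dx (ha : Rep φ a) (i : Fin n) : Rep (dx i φ) ((phaseAlgebra U).X i a) := ha.dir _

theorem dy (ha : Rep φ a) (i : Fin n) : Rep (dy i φ) ((phaseAlgebra U).Y i a) := ha.dir _

theorem y (k : Fin n) : Rep (fun z => z.2 k) ((phaseAlgebra U).y k) := rep_coord k

end Rep

end Finsler
end

/-! ### Finsler metrics on open sets of phase space. -/

noncomputable section

namespace Finsler

open TopologicalSpace

variable {n : ℕ} {U : Opens (Model n × Model n)}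

theorem sum_smul_single (v : Model n) : ∑ k, v k • EuclideanSpace.single k (1 : ℝ) = v := by
  have := (EuclideanSpace.basisFun (Fin n) ℝ).sum_repr v
  simpa using this

theorem sum_mul_fderiv_snd (L : Model n × Model n →L[ℝ] ℝ) (v : Model n) :
    ∑ k, v k * L (0, EuclideanSpace.single k 1) = L (0, v) := by
  have h : ∀ w, L (0, w) = (L.comp (ContinuousLinearMap.inr ℝ (Model n) (Model n))) w :=
    fun w => by simp
  conv_rhs => rw [h, ← sum_smul_single v, map_sum]
  exact Finset.sum_congr rfl fun k _ => by rw [h, map_smul, smul_eq_mul]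

theorem sum_mul_fderiv_fst (L : Model n × Model n →L[ℝ] ℝ) (v : Model n) :
    ∑ k, v k * L (EuclideanSpace.single k 1, 0) = L (v, 0) := by
  have h : ∀ w, L (w, 0) = (L.comp (ContinuousLinearMap.inl ℝ (Model n) (Model n))) w :=
    fun w => by simp
  conv_rhs => rw [h, ← sum_smul_single v, map_sum]
  exact Finset.sum_congr rfl fun k _ => by rw [h, map_smul, smul_eq_mul]

/-- Euler's theorem on homogeneous functions. -/
theorem Rep.euler {φ : Model n × Model n → ℝ} {a : smoothAlgebra U} (ha : Rep φ a) (r : ℕ)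
    (h : ∀ z ∈ U, ∀ c : ℝ, 0 < c → φ (z.1, c • z.2) = c ^ r * φ z) :
    (phaseAlgebra U).C a = (r : ℝ) • a := by
  refine ev_ext fun z => ?_
  rw [PhaseAlgebra.C_apply, map_sum, map_smul, ha]
  have h1 : ∀ k, ev z ((phaseAlgebra U).y k * (phaseAlgebra U).Y k a) =
      z.1.2 k * fderiv ℝ φ z (0, EuclideanSpace.single k 1) := fun k => by
    rw [map_mul, Rep.y, ha.dy]; rfl
  simp only [h1, sum_mul_fderiv_snd]
  have h2 : HasDerivAt (fun c : ℝ => φ (z.1.1, c • z.1.2)) (fderiv ℝ φ z (0, z.1.2)) 1 := by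
    have h3 : HasDerivAt (fun c : ℝ => (z.1.1, c • z.1.2)) ((0 : Model n), z.1.2) 1 := by
      simpa using (hasDerivAt_const (1 : ℝ) z.1.1).prodMk ((hasDerivAt_id (1 : ℝ)).smul_const z.1.2)
    have h4 : HasFDerivAt φ (fderiv ℝ φ z) (z.1.1, (1 : ℝ) • z.1.2) := by
      rw [one_smul]; exact (ha.differentiableAt z.2).hasFDerivAt
    exact h4.comp_hasDerivAt (1 : ℝ) h3
  have h5 : HasDerivAt (fun c : ℝ => c ^ r * φ z) (r * φ z) 1 := by
    simpa using (hasDerivAt_pow r (1 : ℝ)).mul_const (φ z)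
  have h6 : (fun c : ℝ => φ (z.1.1, c • z.1.2)) =ᶠ[nhds 1] fun c => c ^ r * φ z :=
    Filter.eventually_of_mem (Ioi_mem_nhds one_pos) fun c hc => h z z.2 c hc
  exact h2.unique (h5.congr_of_eventuallyEq h6)

/-- Finsler metrics on an open set of phase space. -/
structure IsLocalFinsler (U : Opens (Model n × Model n)) (F : Model n × Model n → ℝ) : Prop where
  smooth : ContDiffOn ℝ ∞ F U
  pos : ∀ z ∈ U, 0 < F z
  homogeneous : ∀ z ∈ U, ∀ c : ℝ, 0 < c → F (z.1, c • z.2) = c * F z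
  nondegenerate : ∀ z ∈ U, (metricTensor F z).det ≠ 0

namespace IsLocalFinsler

variable {F : Model n × Model n → ℝ} (h : IsLocalFinsler U F)
include h

/-- `F` as an element of the algebra of smooth functions. -/
def metric : smoothAlgebra U := ofFun F h.smooth

/-- The metric tensor, with entries in the algebra of smooth functions. -/
def tensor : Matrix (Fin n) (Fin n) (smoothAlgebra U) :=
  Matrix.of fun i j => (1 / 2 : ℝ) •
    (phaseAlgebra U).Y j ((phaseAlgebra U).Y i (h.metric * h.metric))

theorem rep_metric : Rep F h.metric := rep_ofFun _

theorem rep_sq : Rep (fun w => F w ^ 2) (h.metric * h.metric) :=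
  (h.rep_metric.mul h.rep_metric).congr fun _ _ => sq _

theorem rep_tensor (i j : Fin n) : Rep (fun z => metricTensor F z i j) (h.tensor i j) :=
  ((h.rep_sq.dy i).dy j).smul _

theorem map_tensor (z : U) : h.tensor.map (ev z) = metricTensor F z := by
  ext i j
  exact h.rep_tensor i j z

theorem rep_det : Rep (fun z => (metricTensor F z).det) h.tensor.det := fun z => by
  beta_reduce
  rw [← h.map_tensor z, AlgHom.map_det]
  rfl

theorem exists_tensorInv : ∃ b : Matrix (Fin n) (Fin n) (smoothAlgebra U), b * h.tensor = 1 := by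
  obtain ⟨b, hb⟩ := h.rep_det.exists_inv h.nondegenerate
  exact ⟨b • h.tensor.adjugate, by
    rw [Matrix.smul_mul, Matrix.adjugate_mul, smul_smul, mul_comm, hb, one_smul]⟩

/-- The inverse of the metric tensor. -/
def tensorInv : Matrix (Fin n) (Fin n) (smoothAlgebra U) := h.exists_tensorInv.choose

theorem tensorInv_mul : h.tensorInv * h.tensor = 1 := h.exists_tensorInv.choose_spec

theorem rep_tensorInv (i j : Fin n) : Rep (fun z => (metricTensor F z)⁻¹ i j) (h.tensorInv i j) :=
  fun z => by
    have h1 : h.tensorInv.map (ev z) * h.tensor.map (ev z) = 1 := by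
      rw [← Matrix.map_mul, h.tensorInv_mul, Matrix.map_one _ (map_zero _) (map_one _)]
    rw [h.map_tensor] at h1
    beta_reduce
    rw [Matrix.inv_eq_left_inv h1]
    rfl

/-- The spray coefficients. -/
def coeff (i : Fin n) : smoothAlgebra U :=
  (1 / 4 : ℝ) • ∑ j, h.tensorInv i j *
    ((∑ k, (phaseAlgebra U).y k * (phaseAlgebra U).X k
      ((phaseAlgebra U).Y j (h.metric * h.metric))) - (phaseAlgebra U).X j (h.metric * h.metric))

theorem rep_coeff (i : Fin n) : Rep (sprayCoeff F i) (h.coeff i) :=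
  Rep.smul _ (Rep.sum fun j => (h.rep_tensorInv i j).mul
    ((Rep.sum fun k => (Rep.y k).mul ((h.rep_sq.dy j).dx k)).sub (h.rep_sq.dx j)))

theorem rep_two_coeff (i : Fin n) : Rep (fun z => 2 * sprayCoeff F i z) (2 * h.coeff i) :=
  fun z => by rw [map_mul, h.rep_coeff, map_ofNat]

/-- The `FinslerAlgebra` of a Finsler metric on an open set of phase space. -/
def algebra : FinslerAlgebra n (smoothAlgebra U) where
  toPhaseAlgebra := phaseAlgebra U
  F := h.metric
  Finv := (h.rep_metric.exists_inv fun z hz => (h.pos z hz).ne').choose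
  F_inv := (h.rep_metric.exists_inv fun z hz => (h.pos z hz).ne').choose_spec
  euler := by
    have := h.rep_metric.euler 1 (by simpa using h.homogeneous)
    rw [PhaseAlgebra.C_apply] at this
    rw [this]; simp
  g := h.tensor
  ginv := h.tensorInv
  two_g i j := by
    have : ∀ a : smoothAlgebra U, 2 * ((1 / 2 : ℝ) • a) = a := fun a => ev_ext fun z => by
      rw [map_mul, map_smul, map_ofNat, smul_eq_mul]; ring
    exact this _
  ginv_mul := h.tensorInv_mul
  G := h.coeff
  eulerLagrange i := ev_ext fun z => by
    have h1 := eulerLagrange F z (h.nondegenerate z z.2) i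
    have h2 := ((Rep.sum (s := Finset.univ) fun k => (Rep.y k).mul ((h.rep_sq.dy i).dx k)).sub
      (Rep.sum (s := Finset.univ) fun k => (h.rep_two_coeff k).mul ((h.rep_sq.dy i).dy k))) z
    rw [h2, h.rep_sq.dx i z]
    unfold sprayDeriv at h1
    linarith

theorem rep_S {φ : Model n × Model n → ℝ} {a : smoothAlgebra U} (ha : Rep φ a) :
    Rep (sprayDeriv F φ) (h.algebra.S a) := by
  rw [FinslerAlgebra.S_apply]
  exact (Rep.sum fun k => (Rep.y k).mul (ha.dx k)).sub
    (Rep.sum fun k => (h.rep_two_coeff k).mul (ha.dy k))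

theorem rep_conn (i j : Fin n) : Rep (connCoeff F i j) (h.algebra.Y j (h.algebra.G i)) :=
  (h.rep_coeff i).dy j

theorem rep_hor {φ : Model n × Model n → ℝ} {a : smoothAlgebra U} (ha : Rep φ a) (k : Fin n) :
    Rep (horDeriv F k φ) (h.algebra.hor k a) :=
  (ha.dx k).sub (Rep.sum fun m => (h.rep_conn m k).mul (ha.dy m))

theorem rep_curv (i j k : Fin n) : Rep (curvature F i j k) (h.algebra.curv i j k) :=
  (h.rep_hor (h.rep_conn i j) k).sub (h.rep_hor (h.rep_conn i k) j)

theorem S_Y_traceN (hχ : ∀ z ∈ U, ∀ j, chiCurvature F j z = 0) (j : Fin n) :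
    h.algebra.S (h.algebra.Y j h.algebra.traceN) = h.algebra.X j h.algebra.traceN := by
  apply h.algebra.S_Y_traceN
  refine ev_ext fun z => ?_
  have h1 := (Rep.sum (s := Finset.univ) fun i => Rep.sum (s := Finset.univ) fun k =>
    ((h.rep_curv i j k).dy i).mul (Rep.y (U := U) k)) z
  have h2 := hχ z z.2 j
  rw [chiCurvature] at h2
  refine h1.trans ?_
  rw [map_zero]
  have h3 := (mul_eq_zero.mp h2).resolve_left (by norm_num)
  exact h3

/-- Vertical derivatives commute, so the trace in the mean Berwald curvature can be taken before the
other two derivatives: 2E is the vertical Hessian of τ. -/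
theorem rep_meanBerwald (i j : Fin n) : Rep (fun z => 2 * meanBerwald F i j z)
    (h.algebra.Y i (h.algebra.Y j h.algebra.traceN)) := by
  have h1 : h.algebra.Y i (h.algebra.Y j h.algebra.traceN) =
      ∑ k, h.algebra.Y k (h.algebra.Y i (h.algebra.Y j (h.algebra.G k))) := by
    rw [FinslerAlgebra.traceN, map_sum, map_sum]
    refine Finset.sum_congr rfl fun k _ => ?_
    rw [h.algebra.Y_Y k i, h.algebra.Y_Y k j]
  rw [h1]
  refine Rep.congr (Rep.sum (s := Finset.univ) fun k => (((h.rep_coeff k).dy j).dy i).dy k)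
    fun z _ => ?_
  simp only [meanBerwald, berwaldCurvature]
  ring

/-- A function `f` with `2 E_{ij} = f ∂²F/∂yⁱ∂yʲ` is smooth. -/
theorem exists_rep_scalar (hn : 2 ≤ n) {f : Model n × Model n → ℝ}
    (hf : ∀ z ∈ U, ∀ i j, 2 * meanBerwald F i j z = f z * dy i (dy j F) z) :
    ∃ a : smoothAlgebra U, Rep f a ∧ ∀ i j,
      h.algebra.Y i (h.algebra.Y j h.algebra.traceN) = a * h.algebra.Y i (h.algebra.Y j h.metric) := by
  -- Solving the traced equation F g^{ij} 2E_{ij} = (n - 1) f for f gives an explicit smooth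
  -- formula.
  have hrep : Rep f ((n - 1 : ℝ)⁻¹ • (h.algebra.F * ∑ i, ∑ j, h.algebra.ginv i j *
      h.algebra.Y i (h.algebra.Y j h.algebra.traceN))) := fun z => by
    have h1 := congrArg (ev z) h.algebra.sum_ginv_hess_F
    have hn' : (n - 1 : ℝ) ≠ 0 := by
      have : (2 : ℝ) ≤ n := by exact_mod_cast hn
      linarith
    simp only [map_mul, map_sum, map_sub, map_natCast, map_one] at h1
    rw [map_smul, smul_eq_mul, inv_mul_eq_iff_eq_mul₀ hn', ← h1]
    simp only [map_mul, map_sum]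
    rw [mul_assoc, Finset.sum_mul]
    congr 1
    refine Finset.sum_congr rfl fun i _ => ?_
    rw [Finset.sum_mul]
    refine Finset.sum_congr rfl fun j _ => ?_
    have h2 : ev z (h.algebra.Y i (h.algebra.Y j h.algebra.F)) = dy i (dy j F) z :=
      ((h.rep_metric.dy j).dy i) z
    have h3 : ev z (h.algebra.Y i (h.algebra.Y j h.algebra.traceN)) = f z * dy i (dy j F) z :=
      (h.rep_meanBerwald i j z).trans (hf z z.2 i j)
    rw [h2, h3]
    ring
  refine ⟨_, hrep, fun i j => ev_ext fun z => ?_⟩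
  have h2 : ev z (h.algebra.Y i (h.algebra.Y j h.metric)) = dy i (dy j F) z :=
    ((h.rep_metric.dy j).dy i) z
  rw [map_mul, h2, hrep]
  exact (h.rep_meanBerwald i j z).trans (hf z z.2 i j)

end IsLocalFinsler

end Finsler
end

noncomputable section

namespace Finsler

open TopologicalSpace Filter Topology

/-! ### Charts of the tangent bundle -/

variable {n : ℕ} {M : Type*} [TopologicalSpace M] [ChartedSpace (Model n) M]

theorem tangentMap_congr_of_eventuallyEq {N : Type*} [TopologicalSpace N]
    [ChartedSpace (Model n) N] {f g : M → N} {p : TangentBundle (𝓡 n) M}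
    (h : f =ᶠ[𝓝 p.1] g) : tangentMap (𝓡 n) (𝓡 n) f p = tangentMap (𝓡 n) (𝓡 n) g p := by
  refine Bundle.TotalSpace.ext h.eq_of_nhds ?_
  rw [tangentMap, tangentMap, h.mfderiv_eq, h.eq_of_nhds]

/-- The tangent vector with coordinates `z` in the chart `e`. -/
def lift (e : OpenPartialHomeomorph M (Model n)) (z : Model n × Model n) :
    TangentBundle (𝓡 n) M :=
  tangentMap (𝓡 n) (𝓡 n) e.symm ⟨z.1, z.2⟩

/-- The coordinates of a tangent vector in the chart `e`. -/
def coords (e : OpenPartialHomeomorph M (Model n)) (v : TangentBundle (𝓡 n) M) :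
    Model n × Model n :=
  Bundle.TotalSpace.toProd (Model n) (Model n) (tangentMap (𝓡 n) (𝓡 n) e v)

theorem inChart_eq (e : OpenPartialHomeomorph M (Model n)) (φ : TangentBundle (𝓡 n) M → ℝ)
    (z : Model n × Model n) : inChart e φ z = φ (lift e z) := rfl

/-- The points `(x, y)` with `x ∈ Ω` and `y ≠ 0`. -/
def coneOver (Ω : Opens (Model n)) : Opens (Model n × Model n) :=
  ⟨{z | z.1 ∈ Ω ∧ z.2 ≠ 0},
    (Ω.isOpen.preimage continuous_fst).inter (isOpen_ne.preimage continuous_snd)⟩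

/-- The points `(x, y)` with `x` in the target of the chart and `y ≠ 0`. -/
def phaseDomain (e : OpenPartialHomeomorph M (Model n)) : Opens (Model n × Model n) :=
  coneOver ⟨e.target, e.open_target⟩

variable [IsManifold (𝓡 n) ∞ M] {e : OpenPartialHomeomorph M (Model n)}
  (he : e ∈ IsManifold.maximalAtlas (𝓡 n) ∞ M)

include he

omit [IsManifold (𝓡 n) ∞ M] in
theorem mdifferentiableAt_chart {p : M} (hp : p ∈ e.source) :
    MDifferentiableAt (𝓡 n) (𝓡 n) e p :=
  (contMDiffAt_of_mem_maximalAtlas he hp).mdifferentiableAt (by simp)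

omit [IsManifold (𝓡 n) ∞ M] in
theorem mdifferentiableAt_chart_symm {x : Model n} (hx : x ∈ e.target) :
    MDifferentiableAt (𝓡 n) (𝓡 n) e.symm x :=
  (contMDiffAt_symm_of_mem_maximalAtlas he hx).mdifferentiableAt (by simp)

omit [IsManifold (𝓡 n) ∞ M] in
theorem tangentMap_symm_tangentMap {v : TangentBundle (𝓡 n) M} (hv : v.1 ∈ e.source) :
    tangentMap (𝓡 n) (𝓡 n) e.symm (tangentMap (𝓡 n) (𝓡 n) e v) = v := by
  rw [← tangentMap_comp_at v (mdifferentiableAt_chart_symm he (e.map_source hv))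
    (mdifferentiableAt_chart he hv), tangentMap_congr_of_eventuallyEq (f := e.symm ∘ e) (g := id)
      (e.eventually_left_inverse hv), tangentMap_id]
  rfl

omit [IsManifold (𝓡 n) ∞ M] in
theorem tangentMap_tangentMap_symm {v : TangentBundle (𝓡 n) (Model n)} (hv : v.1 ∈ e.target) :
    tangentMap (𝓡 n) (𝓡 n) e (tangentMap (𝓡 n) (𝓡 n) e.symm v) = v := by
  rw [← tangentMap_comp_at v (mdifferentiableAt_chart he (e.map_target hv))
    (mdifferentiableAt_chart_symm he hv), tangentMap_congr_of_eventuallyEq (f := e ∘ e.symm)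
      (g := id) (e.eventually_right_inverse hv), tangentMap_id]
  rfl

omit [IsManifold (𝓡 n) ∞ M] in
theorem lift_coords {v : TangentBundle (𝓡 n) M} (hv : v.1 ∈ e.source) :
    lift e (coords e v) = v :=
  tangentMap_symm_tangentMap he hv

omit [IsManifold (𝓡 n) ∞ M] in
theorem coords_lift {z : Model n × Model n} (hz : z.1 ∈ e.target) : coords e (lift e z) = z :=
  congrArg (Bundle.TotalSpace.toProd (Model n) (Model n))
    (tangentMap_tangentMap_symm he (v := ⟨z.1, z.2⟩) hz)

omit [IsManifold (𝓡 n) ∞ M] in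
theorem lift_mem_slit {z : Model n × Model n} (hz : z ∈ phaseDomain e) : lift e z ∈ slit n M := by
  intro h0
  have h1 := congrArg Prod.snd (coords_lift he hz.1)
  have h2 : (coords e (lift e z)).2 =
      mfderiv (𝓡 n) (𝓡 n) e (lift e z).1 (lift e z).2 := rfl
  rw [h2, h0, map_zero] at h1
  exact hz.2 h1.symm

omit [IsManifold (𝓡 n) ∞ M] in
theorem coords_mem {v : TangentBundle (𝓡 n) M} (hv : v.1 ∈ e.source) (h0 : v ∈ slit n M) :
    coords e v ∈ phaseDomain e := by
  refine ⟨e.map_source hv, fun h => h0 ?_⟩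
  have h1 := lift_coords he hv
  have h2 : lift e (coords e v) = ⟨e.symm (e v.1), mfderiv (𝓡 n) (𝓡 n) e.symm (e v.1)
    (coords e v).2⟩ := rfl
  have h3 : lift e (coords e v) = ⟨e.symm (e v.1), 0⟩ := by
    rw [h2, h]
    congr 1
    exact (mfderiv (𝓡 n) (𝓡 n) e.symm (e v.1)).map_zero
  rw [← h1, h3]

theorem contMDiffOn_lift : ContMDiffOn 𝓘(ℝ, Model n × Model n) (𝓡 n).tangent ∞ (lift e)
    {z | z.1 ∈ e.target} := by
  have h1 := (contMDiffOn_symm_of_mem_maximalAtlas he).contMDiffOn_tangentMapWithin (m := ∞)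
    (by simp) e.open_target.uniqueMDiffOn
  have h2 : ContMDiff 𝓘(ℝ, Model n × Model n) (𝓡 n).tangent ∞
      (fun z : Model n × Model n => (⟨z.1, z.2⟩ : TangentBundle (𝓡 n) (Model n))) := by
    have := contMDiff_tangentBundleModelSpaceHomeomorph_symm (I := 𝓡 n) (n := ∞)
    rw [modelWithCornersSelf_prod]
    exact this
  refine (h1.comp h2.contMDiffOn (fun z hz => hz)).congr fun z hz => ?_
  exact (tangentMapWithin_eq_tangentMap (e.open_target.uniqueMDiffWithinAt hz)
    (mdifferentiableAt_chart_symm he hz)).symm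

theorem contMDiffOn_coords : ContMDiffOn (𝓡 n).tangent 𝓘(ℝ, Model n × Model n) ∞ (coords e)
    {v | v.1 ∈ e.source} := by
  have h1 := (contMDiffOn_of_mem_maximalAtlas he).contMDiffOn_tangentMapWithin (m := ∞)
    (by simp) e.open_source.uniqueMDiffOn
  have h2 : ContMDiff (𝓡 n).tangent 𝓘(ℝ, Model n × Model n) ∞
      (fun v : TangentBundle (𝓡 n) (Model n) => ((v.1, v.2) : Model n × Model n)) := by
    have := contMDiff_tangentBundleModelSpaceHomeomorph (I := 𝓡 n) (n := ∞)
    rw [modelWithCornersSelf_prod]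
    exact this
  refine (h2.comp_contMDiffOn h1).congr fun z hz => ?_
  have := (tangentMapWithin_eq_tangentMap (e.open_source.uniqueMDiffWithinAt hz)
    (mdifferentiableAt_chart he hz)).symm
  simp only [Function.comp_apply, coords]
  rw [this]
  rfl

theorem contDiffOn_inChart {φ : TangentBundle (𝓡 n) M → ℝ}
    (hφ : ContMDiffOn (𝓡 n).tangent 𝓘(ℝ, ℝ) ∞ φ (slit n M)) :
    ContDiffOn ℝ ∞ (inChart e φ) (phaseDomain e) :=
  contMDiffOn_iff_contDiffOn.mp <| hφ.comp ((contMDiffOn_lift he).mono fun _ hz => hz.1)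
    fun _ hz => lift_mem_slit he hz

omit he in
-- Near each vector, φ is the composite of its chart expression with the smooth map `coords`; the
-- vectors over a chart domain form an open set.
theorem contMDiffOn_of_inChart {φ : TangentBundle (𝓡 n) M → ℝ}
    (h : ∀ e ∈ IsManifold.maximalAtlas (𝓡 n) ∞ M, ContDiffOn ℝ ∞ (inChart e φ) (phaseDomain e)) :
    ContMDiffOn (𝓡 n).tangent 𝓘(ℝ, ℝ) ∞ φ (slit n M) := by
  intro v hv
  have he := IsManifold.chart_mem_maximalAtlas (I := 𝓡 n) (n := ∞) v.1
  have hs := mem_chart_source (Model n) v.1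
  have hopen : IsOpen {w : TangentBundle (𝓡 n) M | w.1 ∈ (chartAt (Model n) v.1).source} :=
    (chartAt (Model n) v.1).open_source.preimage (FiberBundle.continuous_proj _ _)
  have h1 : ContMDiffOn (𝓡 n).tangent 𝓘(ℝ, ℝ) ∞
      (inChart (chartAt (Model n) v.1) φ ∘ coords (chartAt (Model n) v.1))
      (slit n M ∩ {w | w.1 ∈ (chartAt (Model n) v.1).source}) :=
    (contMDiffOn_iff_contDiffOn.mpr (h _ he)).comp
      ((contMDiffOn_coords he).mono fun w hw => hw.2) fun w hw => coords_mem he hw.2 hw.1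
  have h2 := (h1.congr (f₁ := φ) fun w hw => by
    rw [Function.comp_apply, inChart_eq, lift_coords he hw.2]) v ⟨hv, hs⟩
  exact h2.mono_of_mem_nhdsWithin (inter_mem_nhdsWithin _ (hopen.mem_nhds hs))

omit he [IsManifold (𝓡 n) ∞ M] in
theorem lift_smul (c : ℝ) (z : Model n × Model n) :
    lift e (z.1, c • z.2) = ⟨(lift e z).1, c • (lift e z).2⟩ := by
  have h3 : lift e (z.1, c • z.2) = ⟨e.symm z.1, mfderiv (𝓡 n) (𝓡 n) e.symm z.1 (c • z.2)⟩ := rfl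
  rw [h3]
  congr 1
  exact (mfderiv (𝓡 n) (𝓡 n) e.symm z.1).map_smul c z.2

omit [IsManifold (𝓡 n) ∞ M] in
theorem inChart_smul {φ : TangentBundle (𝓡 n) M → ℝ} {r : ℕ} (hφ : PosHomogeneous r φ) :
    ∀ z ∈ phaseDomain e, ∀ c : ℝ, 0 < c →
      inChart e φ (z.1, c • z.2) = c ^ r * inChart e φ z := fun z hz c hc => by
  rw [inChart_eq, lift_smul, hφ _ _ (lift_mem_slit he hz) c hc]
  rfl

/-- A Finsler metric in a chart. -/
theorem IsFinsler.isLocalFinsler (hn : n ≠ 0) {F : TangentBundle (𝓡 n) M → ℝ} (hF : IsFinsler F) :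
    IsLocalFinsler (phaseDomain e) (inChart e F) where
  smooth := contDiffOn_inChart he hF.smooth
  pos z hz := by
    -- Positivity follows from nondegeneracy: a zero of F is a minimum, so F and dF vanish there,
    -- and g = dF ⊗ dF + F Hess F would be zero.
    refine lt_of_le_of_ne (hF.nonneg _) fun h0 => hF.nondegenerate e he z.1 hz.1 z.2 hz.2 ?_
    have hr := rep_ofFun (contDiffOn_inChart he hF.smooth)
    have hmin : IsLocalMin (inChart e F) z :=
      Filter.Eventually.of_forall fun w => by rw [← h0]; exact hF.nonneg _
    have hd : ∀ i, dy i (inChart e F) z = 0 := fun i => by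
      rw [dy, hmin.fderiv_eq_zero]; rfl
    have hg : metricTensor (inChart e F) z = 0 := by
      ext i j
      have h1 : Rep (fun w => inChart e F w ^ 2) _ := (hr.mul hr).congr fun w _ => sq _
      have h2 : ∀ w ∈ phaseDomain e, dy i (fun w => inChart e F w ^ 2) w =
          2 * (inChart e F w * dy i (inChart e F) w) := fun w hw => by
        rw [← (h1.dy i) ⟨w, hw⟩, derivation_mul, map_add, map_mul, hr.dy i, hr]; ring
      have h3 := (h1.dy i).dy j ⟨z, hz⟩
      rw [derivation_mul, map_add, map_add, derivation_mul, map_add, map_mul, map_mul, hr,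
        hr.dy i, hr.dy j, hd, hd, ← h0] at h3
      have h4 : dy j (dy i fun w => inChart e F w ^ 2) z = 0 := by
        rw [← h3]; ring
      simp [metricTensor, h4]
    -- The zero matrix of size 0 has determinant 1, so n ≠ 0 is needed.
    have : Nonempty (Fin n) := Fin.pos_iff_nonempty.mp (Nat.pos_of_ne_zero hn)
    rw [hg, Matrix.det_zero]
  homogeneous := by simpa using inChart_smul he hF.homogeneous
  nondegenerate z hz := hF.nondegenerate e he z.1 hz.1 z.2 hz.2

end Finsler
end

/-! ### The first integral property and local constancy. -/

noncomputable section

namespace Finsler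

open TopologicalSpace Filter Topology

variable {n : ℕ}

theorem Rep.fderiv_eq_zero {U : Opens (Model n × Model n)} {φ : Model n × Model n → ℝ}
    {a : smoothAlgebra U} (ha : Rep φ a) (hX : ∀ k, (phaseAlgebra U).X k a = 0)
    (hY : ∀ k, (phaseAlgebra U).Y k a = 0) {z : Model n × Model n} (hz : z ∈ U) :
    fderiv ℝ φ z = 0 := by
  refine ContinuousLinearMap.ext_iff.mpr fun v => ?_
  have h1 : ∀ k, fderiv ℝ φ z (EuclideanSpace.single k 1, 0) = 0 := fun k => by
    have := ha.dx k ⟨z, hz⟩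
    rw [hX, map_zero] at this
    exact this.symm
  have h2 : ∀ k, fderiv ℝ φ z (0, EuclideanSpace.single k 1) = 0 := fun k => by
    have := ha.dy k ⟨z, hz⟩
    rw [hY, map_zero] at this
    exact this.symm
  have h3 : v = (v.1, 0) + (0, v.2) := by simp
  rw [h3, map_add, ← sum_mul_fderiv_fst, ← sum_mul_fderiv_snd]
  simp [h1, h2]

variable {M : Type*} [TopologicalSpace M] [ChartedSpace (Model n) M]
  [IsManifold (𝓡 n) ∞ M] {F f : TangentBundle (𝓡 n) M → ℝ}
  {e : OpenPartialHomeomorph M (Model n)}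

omit [IsManifold (𝓡 n) ∞ M] in
/-- In every chart, `f` is smooth and invariant under the geodesic spray. -/
theorem exists_rep_chart (hn : 2 ≤ n) (he : e ∈ IsManifold.maximalAtlas (𝓡 n) ∞ M)
    (hF : IsLocalFinsler (phaseDomain e) (inChart e F)) (hχ : ChiVanishes F)
    (hf : HasScalarMeanBerwald F f) :
    ∃ a : smoothAlgebra (phaseDomain e), Rep (inChart e f) a ∧ hF.algebra.S a = 0 ∧
      (∀ i j, hF.algebra.Y i (hF.algebra.Y j hF.algebra.traceN) =
        a * hF.algebra.Y i (hF.algebra.Y j hF.algebra.F)) ∧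
      (2 < n → (∀ k, hF.algebra.X k a = 0) ∧ ∀ k, hF.algebra.Y k a = 0) := by
  obtain ⟨a, ha, hess⟩ := hF.exists_rep_scalar hn fun z hz => hf.2 e he z.1 hz.1 z.2 hz.2
  have hS : hF.algebra.S a = 0 := hF.algebra.S_eq_zero_of_hess hn
    (hF.S_Y_traceN fun z hz => hχ e he z.1 hz.1 z.2 hz.2) hess
  refine ⟨a, ha, hS, hess, fun hn' => ?_⟩
  have hC : hF.algebra.C a = 0 := by
    have := ha.euler 0 (inChart_smul he hf.1)
    rwa [Nat.cast_zero, zero_smul] at this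
  have hY := hF.algebra.Y_eq_zero_of_hess hn' hC hess
  exact ⟨hF.algebra.X_eq_zero_of_S hS hY, hY⟩

theorem isFirstIntegral (hn : 2 ≤ n) (hF : IsFinsler F) (hχ : ChiVanishes F)
    (hf : HasScalarMeanBerwald F f) : IsFirstIntegral F f := by
  refine ⟨contMDiffOn_of_inChart fun e he => ?_, fun e he x hx y hy => ?_⟩
  · obtain ⟨a, ha, -⟩ := exists_rep_chart hn he (hF.isLocalFinsler he (by omega)) hχ hf
    exact ha.contDiffOn
  · have hF' := hF.isLocalFinsler he (by omega)
    obtain ⟨a, ha, hS, -⟩ := exists_rep_chart hn he hF' hχ hf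
    have := hF'.rep_S ha ⟨(x, y), hx, hy⟩
    rw [hS, map_zero] at this
    exact this.symm

/-- In dimension at least three, `f` is locally constant. -/
theorem exists_isLocallyConstant (hn : 2 < n) (hF : IsFinsler F) (hχ : ChiVanishes F)
    (hf : HasScalarMeanBerwald F f) :
    ∃ κ : M → ℝ, IsLocallyConstant κ ∧ ∀ v ∈ slit n M, f v = κ v.1 := by
  have key : ∀ p : M, ∃ V ∈ 𝓝 p, ∃ c : ℝ, ∀ v ∈ slit n M, v.1 ∈ V → f v = c := fun p => by
    have he := IsManifold.chart_mem_maximalAtlas (I := 𝓡 n) (n := ∞) p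
    set e := chartAt (Model n) p with he'
    obtain ⟨a, ha, -, -, h0⟩ := exists_rep_chart hn.le he (hF.isLocalFinsler he (by omega)) hχ hf
    have hp : p ∈ e.source := mem_chart_source _ _
    obtain ⟨r, hr, hball⟩ := Metric.isOpen_iff.mp e.open_target _ (e.map_source hp)
    have hsub : Metric.ball (e p) r ×ˢ ({0}ᶜ : Set (Model n)) ⊆ phaseDomain e :=
      fun z hz => ⟨hball hz.1, hz.2⟩
    -- In dimension greater than one a fibre without its origin is connected, so the product with a
    -- ball is preconnected and a zero derivative forces a constant.
    have hrank : 1 < Module.rank ℝ (Model n) := by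
      rw [← Module.finrank_eq_rank, finrank_euclideanSpace, Fintype.card_fin]
      exact_mod_cast (by omega : 1 < n)
    obtain ⟨c, hc⟩ := (Metric.isOpen_ball.prod isOpen_compl_singleton).exists_is_const_of_fderiv_eq_zero
      ((convex_ball (e p) r).isPreconnected.prod
        (isConnected_compl_singleton_of_one_lt_rank hrank (0 : Model n)).isPreconnected)
      (fun z hz => (ha.differentiableAt (hsub hz)).differentiableWithinAt)
      (fun z hz => ha.fderiv_eq_zero (h0 hn).1 (h0 hn).2 (hsub hz))
    refine ⟨e.source ∩ e ⁻¹' Metric.ball (e p) r,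
      (e.isOpen_inter_preimage Metric.isOpen_ball).mem_nhds ⟨hp, Metric.mem_ball_self hr⟩, c,
      fun v hv hvV => ?_⟩
    rw [← hc (coords e v) ⟨hvV.2, (coords_mem he hvV.1 hv).2⟩, inChart_eq, lift_coords he hvV.1]
  have hne : EuclideanSpace.single (⟨0, by omega⟩ : Fin n) (1 : ℝ) ≠ 0 := by simp
  -- Only a nonzero vector over each point is needed; continuity of this section plays no role.
  let σ : M → TangentBundle (𝓡 n) M := fun p =>
    ⟨p, EuclideanSpace.single (⟨0, by omega⟩ : Fin n) (1 : ℝ)⟩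
  have hσ : ∀ p, σ p ∈ slit n M := fun p => hne
  refine ⟨fun p => f (σ p), (IsLocallyConstant.iff_eventually_eq _).mpr fun p => ?_, fun v hv => ?_⟩
  · obtain ⟨V, hV, c, hc⟩ := key p
    filter_upwards [hV] with q hq
    rw [hc _ (hσ q) hq, hc _ (hσ p) (mem_of_mem_nhds hV)]
  · obtain ⟨V, hV, c, hc⟩ := key v.1
    beta_reduce
    rw [hc _ hv (mem_of_mem_nhds hV), hc _ (hσ v.1) (mem_of_mem_nhds hV)]

end Finsler
end

noncomputable section

namespace Finsler

open TopologicalSpace Filter Topology MeasureTheory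

variable {n : ℕ}

/-! ### Integration on phase space -/

instance : (volume : Measure (Model n × Model n)).IsAddHaarMeasure :=
  inferInstanceAs ((volume : Measure (Model n)).prod (volume : Measure (Model n))).IsAddHaarMeasure

/-- Integration by parts against the constant function 1. -/
theorem integral_fderiv_eq_zero {φ : Model n × Model n → ℝ} (hφ : ContDiff ℝ ∞ φ)
    (hc : HasCompactSupport φ) (v : Model n × Model n) : ∫ z, fderiv ℝ φ z v = 0 := by
  have hd : Continuous fun z => fderiv ℝ φ z v :=
    (hφ.continuous_fderiv (by simp)).clm_apply continuous_const
  have hdc : HasCompactSupport fun z => fderiv ℝ φ z v := hc.fderiv_apply (𝕜 := ℝ) v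
  have := integral_mul_fderiv_eq_neg_fderiv_mul_of_integrable (𝕜 := ℝ) (μ := volume)
    (f := fun _ : Model n × Model n => (1 : ℝ)) (g := φ) (v := v) (by simp)
    (by simpa using hd.integrable_of_hasCompactSupport hdc)
    (by simpa using hφ.continuous.integrable_of_hasCompactSupport hc)
    (fun _ _ => differentiableAt_const _)
    (fun x _ => hφ.differentiable (by simp) x)
  simpa using this

variable {U : Opens (Model n × Model n)}

/-- Extension by zero. -/
def zeroExt (a : smoothAlgebra U) (z : Model n × Model n) : ℝ :=
  open Classical in if h : z ∈ U then ev ⟨z, h⟩ a else 0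

theorem zeroExt_of_mem (a : smoothAlgebra U) {z : Model n × Model n} (hz : z ∈ U) :
    zeroExt a z = ev ⟨z, hz⟩ a := dif_pos hz

theorem zeroExt_of_notMem (a : smoothAlgebra U) {z : Model n × Model n} (hz : z ∉ U) :
    zeroExt a z = 0 := dif_neg hz

theorem rep_zeroExt (a : smoothAlgebra U) : Rep (zeroExt a) a := fun z => by
  rw [zeroExt_of_mem a z.2]

/-- The ideal of compactly supported smooth functions. -/
def compactIdeal (U : Opens (Model n × Model n)) : Ideal (smoothAlgebra U) where
  carrier := {a | ∃ K : Set (Model n × Model n), IsCompact K ∧ K ⊆ U ∧ ∀ z : U, z.1 ∉ K → ev z a = 0}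
  zero_mem' := ⟨∅, isCompact_empty, Set.empty_subset _, fun z _ => map_zero _⟩
  add_mem' := by
    rintro a b ⟨K, hK, hKU, ha⟩ ⟨L, hL, hLU, hb⟩
    refine ⟨K ∪ L, hK.union hL, Set.union_subset hKU hLU, fun z hz => ?_⟩
    rw [map_add, ha z fun h => hz (Or.inl h), hb z fun h => hz (Or.inr h), add_zero]
  smul_mem' := by
    rintro c a ⟨K, hK, hKU, ha⟩
    exact ⟨K, hK, hKU, fun z hz => by rw [smul_eq_mul, map_mul, ha z hz, mul_zero]⟩

section

variable {a : smoothAlgebra U}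

theorem zeroExt_eventually_zero {K : Set (Model n × Model n)} (hK : IsCompact K)
    (ha : ∀ z : U, z.1 ∉ K → ev z a = 0) {z : Model n × Model n} (hz : z ∉ K) :
    zeroExt a =ᶠ[𝓝 z] fun _ => 0 := by
  filter_upwards [hK.isClosed.isOpen_compl.mem_nhds hz] with w hw
  by_cases h : w ∈ U
  · rw [zeroExt_of_mem a h, ha ⟨w, h⟩ hw]
  · exact zeroExt_of_notMem a h

theorem contDiff_zeroExt (ha : a ∈ compactIdeal U) : ContDiff ℝ ∞ (zeroExt a) := by
  obtain ⟨K, hK, hKU, h0⟩ := ha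
  refine contDiff_iff_contDiffAt.mpr fun z => ?_
  by_cases hz : z ∈ U
  · exact (rep_zeroExt a).contDiffAt hz
  · exact contDiffAt_const.congr_of_eventuallyEq
      (zeroExt_eventually_zero hK h0 fun h => hz (hKU h))

theorem hasCompactSupport_zeroExt (ha : a ∈ compactIdeal U) : HasCompactSupport (zeroExt a) := by
  obtain ⟨K, hK, hKU, h0⟩ := ha
  exact HasCompactSupport.intro hK fun z hz => (zeroExt_eventually_zero hK h0 hz).eq_of_nhds

theorem integrable_zeroExt (ha : a ∈ compactIdeal U) : Integrable (zeroExt a) :=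
  (contDiff_zeroExt ha).continuous.integrable_of_hasCompactSupport (hasCompactSupport_zeroExt ha)

theorem zeroExt_dir (ha : a ∈ compactIdeal U) (v : Model n × Model n) :
    zeroExt (dir v a) = fun z => fderiv ℝ (zeroExt a) z v := by
  funext z
  by_cases hz : z ∈ U
  · rw [zeroExt_of_mem _ hz, (rep_zeroExt a).dir v]
  · obtain ⟨K, hK, hKU, h0⟩ := ha
    rw [zeroExt_of_notMem _ hz,
      (zeroExt_eventually_zero hK h0 fun h => hz (hKU h)).fderiv_eq]
    simp

theorem dir_mem (ha : a ∈ compactIdeal U) (v : Model n × Model n) :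
    dir v a ∈ compactIdeal U := by
  obtain ⟨K, hK, hKU, h0⟩ := ha
  refine ⟨K, hK, hKU, fun z hz => ?_⟩
  rw [(rep_zeroExt a).dir v]
  beta_reduce
  rw [(zeroExt_eventually_zero hK h0 hz).fderiv_eq]
  simp

end

theorem stokes (U : Opens (Model n × Model n)) :
    FinslerAlgebra.Stokes (phaseAlgebra U) (compactIdeal U) fun a => ∫ z, zeroExt a z where
  X_mem _ _ ha := dir_mem ha _
  Y_mem _ _ ha := dir_mem ha _
  add a ha b hb := by
    rw [← integral_add (integrable_zeroExt ha) (integrable_zeroExt hb)]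
    congr 1
    funext z
    by_cases hz : z ∈ U
    · simp only [zeroExt_of_mem _ hz, map_add]
    · simp only [zeroExt_of_notMem _ hz, add_zero]
  X_eq k a ha := by
    change ∫ z, zeroExt (dir _ a) z = 0
    rw [zeroExt_dir ha]
    exact integral_fderiv_eq_zero (contDiff_zeroExt ha) (hasCompactSupport_zeroExt ha) _
  Y_eq k a ha := by
    change ∫ z, zeroExt (dir _ a) z = 0
    rw [zeroExt_dir ha]
    exact integral_fderiv_eq_zero (contDiff_zeroExt ha) (hasCompactSupport_zeroExt ha) _

theorem integral_zeroExt {φ : Model n × Model n → ℝ} {a : smoothAlgebra U} (ha : Rep φ a) :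
    ∫ z, zeroExt a z = ∫ z in U, φ z := by
  rw [← integral_indicator U.isOpen.measurableSet]
  congr 1
  funext z
  by_cases hz : z ∈ U
  · rw [zeroExt_of_mem _ hz, ha, Set.indicator_of_mem hz]
  · rw [zeroExt_of_notMem _ hz, Set.indicator_of_notMem hz]

theorem Rep.integrableOn {φ : Model n × Model n → ℝ} {a : smoothAlgebra U} (ha : Rep φ a)
    (hK : a ∈ compactIdeal U) : IntegrableOn φ U :=
  (integrable_zeroExt hK).integrableOn.congr_fun
    (fun z hz => by rw [zeroExt_of_mem _ hz, ha]) U.isOpen.measurableSet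

theorem Rep.dy_eq_zero_of_fst {h : Model n → ℝ} {a : smoothAlgebra U}
    (ha : Rep (fun z => h z.1) a) (k : Fin n) : (phaseAlgebra U).Y k a = 0 := by
  refine ev_ext fun z => ?_
  rw [ha.dy k, map_zero, Finsler.dy, ← (ha.differentiableAt z.2).lineDeriv_eq_fderiv]
  simp [lineDeriv]

namespace IsLocalFinsler

variable {F : Model n × Model n → ℝ}

theorem mono {V : Opens (Model n × Model n)} (h : IsLocalFinsler U F) (hV : V ≤ U) :
    IsLocalFinsler V F where
  smooth := h.smooth.mono hV
  pos z hz := h.pos z (hV hz)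
  homogeneous z hz := h.homogeneous z (hV hz)
  nondegenerate z hz := h.nondegenerate z (hV hz)

variable (h : IsLocalFinsler U F)
include h

/-- The metric tensor may be indefinite, so its determinant may be negative. The absolute value is
smooth away from zero, and `Real.log` of a negative number is the logarithm of its absolute value.
-/
theorem exists_isLiouville : ∃ W L : smoothAlgebra U, Rep (fun z => |(metricTensor F z).det|) W ∧
    Rep (fun z => 1 / 2 * Real.log (metricTensor F z).det) L ∧ h.algebra.IsLiouville W L := by
  obtain ⟨W, hW⟩ := h.rep_det.exists_comp (h := fun t => |t|)
    fun z hz => contDiffAt_abs (h.nondegenerate z hz)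
  obtain ⟨L, hL⟩ := h.rep_det.exists_comp (h := fun t => 1 / 2 * Real.log t)
    fun z hz => contDiffAt_const.mul (Real.contDiffAt_log.mpr (h.nondegenerate z hz))
  obtain ⟨c, hc⟩ := h.rep_det.exists_comp (h := fun t => 1 / 2 * t⁻¹)
    fun z hz => contDiffAt_const.mul (contDiffAt_inv ℝ (h.nondegenerate z hz))
  have key : ∀ v, 2 * h.tensor.det * dir v L = dir v h.tensor.det := fun v => by
    rw [dir_comp (h := fun t => 1 / 2 * Real.log t) (h' := fun t => 1 / 2 * t⁻¹) h.rep_det hL hc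
      (fun z hz => (Real.hasDerivAt_log (h.nondegenerate z hz)).const_mul _) v]
    refine ev_ext fun z => ?_
    rw [map_mul, map_mul, map_mul, hc, h.rep_det, map_ofNat]
    have := h.nondegenerate z z.2
    field_simp
  refine ⟨W, L, hW, hL, ⟨ev_ext fun z => ?_, fun k => key _, fun k => key _⟩⟩
  rw [map_mul, map_mul, hW]
  change _ = ev z h.tensor.det * ev z h.tensor.det
  rw [h.rep_det]
  exact abs_mul_abs_self _

theorem exists_isCutoff {θ : ℝ → ℝ} (hθ : ContDiff ℝ ∞ θ) : ∃ θ₀ θ₁ θ₂ : smoothAlgebra U,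
    Rep (fun z => θ (F z ^ 2 / 2)) θ₀ ∧ Rep (fun z => deriv θ (F z ^ 2 / 2)) θ₁ ∧
      h.algebra.IsCutoff θ₀ θ₁ θ₂ := by
  have hH : Rep (fun z => F z ^ 2 / 2) ((1 / 2 : ℝ) • (h.metric * h.metric)) :=
    (h.rep_sq.smul (1 / 2)).congr fun z _ => by ring
  have hθ1 : ContDiff ℝ ∞ (deriv θ) := (contDiff_infty_iff_deriv.mp hθ).2
  have hθ2 : ContDiff ℝ ∞ (deriv (deriv θ)) := (contDiff_infty_iff_deriv.mp hθ1).2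
  obtain ⟨θ₀, h0⟩ := hH.exists_comp fun z _ => hθ.contDiffAt
  obtain ⟨θ₁, h1⟩ := hH.exists_comp fun z _ => hθ1.contDiffAt
  obtain ⟨θ₂, h2⟩ := hH.exists_comp fun z _ => hθ2.contDiffAt
  have hd : ∀ v, dir v ((1 / 2 : ℝ) • (h.metric * h.metric)) = h.metric * dir v h.metric :=
    fun v => by
      rw [Derivation.map_smul, derivation_mul]
      refine ev_ext fun z => ?_
      rw [map_smul, smul_eq_mul, map_add]; ring
  have key0 : ∀ v, dir v θ₀ = θ₁ * (h.metric * dir v h.metric) := fun v => by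
    rw [← hd]
    exact dir_comp hH h0 h1 (fun z _ => (hθ.differentiable (by simp) _).hasDerivAt) v
  have key1 : ∀ v, dir v θ₁ = θ₂ * (h.metric * dir v h.metric) := fun v => by
    rw [← hd]
    exact dir_comp hH h1 h2 (fun z _ => (hθ1.differentiable (by simp) _).hasDerivAt) v
  exact ⟨θ₀, θ₁, θ₂, h0, h1, fun k => key0 _, fun k => key1 _, fun k => key1 _⟩

end IsLocalFinsler

/-- By homogeneity every z with F(z) in [r, R] is the multiple F(z)/F(u) of its Euclidean unit
direction u. The shell over S is thus a continuous image of S × sphere × [r, R]; r > 0 keeps it off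
the zero section. -/
theorem mem_compactIdeal {Ω : Opens (Model n)} {F : Model n × Model n → ℝ}
    (h : IsLocalFinsler (coneOver Ω) F) {S : Set (Model n)} (hS : IsCompact S) (hSΩ : S ⊆ Ω)
    {r R : ℝ} (hr : 0 < r) {a : smoothAlgebra (coneOver Ω)}
    (ha : ∀ z, ev z a ≠ 0 → z.1.1 ∈ S ∧ F z ∈ Set.Icc r R) : a ∈ compactIdeal (coneOver Ω) := by
  have hmem : ∀ w : (Model n × Model n) × ℝ,
      w ∈ (S ×ˢ Metric.sphere (0 : Model n) 1) ×ˢ Set.Icc r R → w.1 ∈ coneOver Ω := fun w hw =>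
    ⟨hSΩ hw.1.1, fun h0 => by
      have := hw.1.2
      rw [h0] at this
      simp at this⟩
  refine ⟨(fun w : (Model n × Model n) × ℝ => (w.1.1, (w.2 / F w.1) • w.1.2)) ''
    ((S ×ˢ Metric.sphere (0 : Model n) 1) ×ˢ Set.Icc r R), ?_, ?_, fun z hz => ?_⟩
  · refine ((hS.prod (isCompact_sphere _ _)).prod isCompact_Icc).image_of_continuousOn ?_
    have hF : ContinuousOn (fun w : (Model n × Model n) × ℝ => F w.1)
        ((S ×ˢ Metric.sphere (0 : Model n) 1) ×ˢ Set.Icc r R) :=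
      h.smooth.continuousOn.comp continuousOn_fst hmem
    exact (continuous_fst.comp continuous_fst).continuousOn.prodMk
      ((continuousOn_snd.div hF fun w hw => (h.pos _ (hmem w hw)).ne').smul
        (continuous_snd.comp continuous_fst).continuousOn)
  · rintro _ ⟨w, hw, rfl⟩
    have := hmem w hw
    exact ⟨this.1, smul_ne_zero (div_ne_zero (hr.trans_le hw.2.1).ne' (h.pos _ this).ne') this.2⟩
  · by_contra hne
    obtain ⟨h1, h2⟩ := ha z hne
    have hy : 0 < ‖z.1.2‖ := norm_pos_iff.mpr z.2.2
    have hu : (z.1.1, ‖z.1.2‖⁻¹ • z.1.2) ∈ coneOver Ω :=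
      ⟨z.2.1, smul_ne_zero (inv_ne_zero hy.ne') z.2.2⟩
    refine hz ⟨((z.1.1, ‖z.1.2‖⁻¹ • z.1.2), F z), ⟨⟨h1, ?_⟩, h2⟩, ?_⟩
    · simp [norm_smul, hy.ne']
    · have hFz := h.pos z z.2
      simp only [h.homogeneous z z.2 _ (inv_pos.mpr hy), smul_smul]
      have : F z / (‖z.1.2‖⁻¹ * F z) * ‖z.1.2‖⁻¹ = 1 := by field_simp
      rw [this, one_smul]

end Finsler
end

noncomputable section

namespace Finsler

open TopologicalSpace Filter Topology MeasureTheory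

variable {n : ℕ}

/-! ### Changes of coordinates -/

/-- The change of the coordinates `(x, y)` induced by a change `ψ` of the coordinates `x`. -/
def prolong (ψ : Model n → Model n) (z : Model n × Model n) : Model n × Model n :=
  (ψ z.1, fderiv ℝ ψ z.1 z.2)

/-- The derivative of `prolong ψ`. -/
def prolongDeriv (ψ : Model n → Model n) (z : Model n × Model n) :
    Model n × Model n →L[ℝ] Model n × Model n :=
  ((fderiv ℝ ψ z.1).comp (ContinuousLinearMap.fst ℝ _ _)).prod
    ((fderiv ℝ ψ z.1).comp (ContinuousLinearMap.snd ℝ _ _) +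
      ((fderiv ℝ (fderiv ℝ ψ) z.1).flip z.2).comp (ContinuousLinearMap.fst ℝ _ _))

/-- The derivative is block triangular with the Jacobian of ψ twice on the diagonal. This square
matches the one in the transformation of det g, which makes |det g| dx dy invariant. -/
theorem det_prolongDeriv (ψ : Model n → Model n) (z : Model n × Model n) :
    (prolongDeriv ψ z).det = (fderiv ℝ ψ z.1).det ^ 2 := by
  set b := (EuclideanSpace.basisFun (Fin n) ℝ).toBasis with hb
  have h1 : LinearMap.toMatrix (b.prod b) (b.prod b)
      (prolongDeriv ψ z : Model n × Model n →ₗ[ℝ] Model n × Model n) =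
      Matrix.fromBlocks (LinearMap.toMatrix b b (fderiv ℝ ψ z.1 : Model n →ₗ[ℝ] Model n)) 0
        (LinearMap.toMatrix b b ((fderiv ℝ (fderiv ℝ ψ) z.1).flip z.2 : Model n →ₗ[ℝ] Model n))
        (LinearMap.toMatrix b b (fderiv ℝ ψ z.1 : Model n →ₗ[ℝ] Model n)) := by
    ext i j
    rcases i with i | i <;> rcases j with j | j <;>
      simp [LinearMap.toMatrix_apply, prolongDeriv]
  rw [ContinuousLinearMap.det, ← LinearMap.det_toMatrix (b.prod b), h1,
    Matrix.det_fromBlocks_zero₁₂, LinearMap.det_toMatrix, sq, ContinuousLinearMap.det]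

variable {Ω : Opens (Model n)} {ψ : Model n → Model n}

theorem contDiffOn_fderiv_chart (hψ : ContDiffOn ℝ ∞ ψ Ω) : ContDiffOn ℝ ∞ (fderiv ℝ ψ) Ω :=
  hψ.fderiv_of_isOpen Ω.isOpen (by simp)

theorem hasFDerivAt_prolong (hψ : ContDiffOn ℝ ∞ ψ Ω) {z : Model n × Model n} (hz : z.1 ∈ Ω) :
    HasFDerivAt (prolong ψ) (prolongDeriv ψ z) z := by
  have h1 : HasFDerivAt ψ (fderiv ℝ ψ z.1) z.1 :=
    ((hψ.contDiffAt (Ω.isOpen.mem_nhds hz)).differentiableAt (by simp)).hasFDerivAt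
  have h2 : HasFDerivAt (fderiv ℝ ψ) (fderiv ℝ (fderiv ℝ ψ) z.1) z.1 :=
    (((contDiffOn_fderiv_chart hψ).contDiffAt (Ω.isOpen.mem_nhds hz)).differentiableAt
      (by simp)).hasFDerivAt
  exact ((h1.comp z hasFDerivAt_fst).prodMk
    ((h2.comp z hasFDerivAt_fst).clm_apply hasFDerivAt_snd)).congr_fderiv rfl

theorem contDiffOn_prolong (hψ : ContDiffOn ℝ ∞ ψ Ω) :
    ContDiffOn ℝ ∞ (prolong ψ) (coneOver Ω) := by
  have hfst : ContDiffOn ℝ ∞ Prod.fst (coneOver Ω : Set (Model n × Model n)) :=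
    contDiff_fst.contDiffOn
  exact (hψ.comp hfst fun z hz => hz.1).prodMk
    (((contDiffOn_fderiv_chart hψ).comp hfst fun z hz => hz.1).clm_apply contDiff_snd.contDiffOn)

/-- The Jacobian matrix of `ψ`. -/
def jacobian (ψ : Model n → Model n) (x : Model n) : Matrix (Fin n) (Fin n) ℝ :=
  Matrix.of fun a i => fderiv ℝ ψ x (EuclideanSpace.single i 1) a

theorem det_jacobian (ψ : Model n → Model n) (x : Model n) :
    (jacobian ψ x).det = (fderiv ℝ ψ x).det := by
  rw [ContinuousLinearMap.det, ← LinearMap.det_toMatrix (EuclideanSpace.basisFun (Fin n) ℝ).toBasis]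
  congr 1

theorem exists_rep_jacobian (hψ : ContDiffOn ℝ ∞ ψ Ω) (a i : Fin n) :
    ∃ c : smoothAlgebra (coneOver Ω), Rep (fun z => jacobian ψ z.1 a i) c ∧
      ∀ k, (phaseAlgebra (coneOver Ω)).Y k c = 0 := by
  have h : ContDiffOn ℝ ∞ (fun z : Model n × Model n => jacobian ψ z.1 a i) (coneOver Ω) :=
    (EuclideanSpace.proj (𝕜 := ℝ) a).contDiff.comp_contDiffOn
      (((contDiffOn_fderiv_chart hψ).comp contDiff_fst.contDiffOn fun z hz => hz.1).clm_apply
        contDiffOn_const)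
  have hr := rep_ofFun (U := coneOver Ω) h
  exact ⟨_, hr, fun k => Rep.dy_eq_zero_of_fst (h := fun x => jacobian ψ x a i) hr k⟩

variable {U : Opens (Model n × Model n)}

theorem Rep.exists_prolong (hψ : ContDiffOn ℝ ∞ ψ Ω)
    (hU : ∀ z ∈ coneOver Ω, prolong ψ z ∈ U) {φ : Model n × Model n → ℝ} {a : smoothAlgebra U}
    (ha : Rep φ a) : ∃ b : smoothAlgebra (coneOver Ω), Rep (fun z => φ (prolong ψ z)) b :=
  ⟨_, rep_ofFun (ha.contDiffOn.comp (contDiffOn_prolong hψ) hU)⟩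

theorem Rep.dy_prolong (hψ : ContDiffOn ℝ ∞ ψ Ω)
    (hU : ∀ z ∈ coneOver Ω, prolong ψ z ∈ U) {φ : Model n × Model n → ℝ} {a : smoothAlgebra U}
    (ha : Rep φ a) {z : Model n × Model n} (hz : z ∈ coneOver Ω) (i : Fin n) :
    Finsler.dy i (fun z => φ (prolong ψ z)) z =
      ∑ b, jacobian ψ z.1 b i * Finsler.dy b φ (prolong ψ z) := by
  have h1 := ((ha.differentiableAt (hU z hz)).hasFDerivAt.comp z
    (hasFDerivAt_prolong hψ hz.1)).fderiv
  rw [Function.comp_def] at h1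
  rw [Finsler.dy, h1]
  have h2 : prolongDeriv ψ z (0, EuclideanSpace.single i 1) =
      (0, fderiv ℝ ψ z.1 (EuclideanSpace.single i 1)) := by simp [prolongDeriv]
  rw [ContinuousLinearMap.comp_apply, h2, ← sum_mul_fderiv_snd]
  rfl

/-- The transformation rule of the metric tensor. -/
theorem metricTensor_prolong (hψ : ContDiffOn ℝ ∞ ψ Ω) (hU : ∀ z ∈ coneOver Ω, prolong ψ z ∈ U)
    {F F' : Model n × Model n → ℝ} {a : smoothAlgebra U} (ha : Rep F' a)
    (hF : ∀ z ∈ coneOver Ω, F z = F' (prolong ψ z)) {z : Model n × Model n}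
    (hz : z ∈ coneOver Ω) :
    metricTensor F z =
      (jacobian ψ z.1).transpose * metricTensor F' (prolong ψ z) * jacobian ψ z.1 := by
  have hsq : Rep (fun w => F' w ^ 2) (a * a) := (ha.mul ha).congr fun z _ => sq _
  obtain ⟨b, hb⟩ := hsq.exists_prolong hψ hU
  have hb' : Rep (fun z => F z ^ 2) b := hb.congr fun z hz => by rw [hF z hz]
  choose c hc hc0 using fun p : Fin n × Fin n => exists_rep_jacobian hψ p.1 p.2
  choose d hd using fun k => (hsq.dy k).exists_prolong hψ hU
  ext i j
  have h1 : Rep (dy i fun w => F w ^ 2) (∑ k, c (k, i) * d k) :=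
    (Rep.sum (s := Finset.univ) fun k => (hc (k, i)).mul (hd k)).congr fun w hw => by
      rw [hb'.dy i |>.eq_on (hb.dy i) hw, hsq.dy_prolong hψ hU hw]
  have h2 := h1.dy j ⟨z, hz⟩
  rw [map_sum, map_sum] at h2
  have h3 : ∀ k, ev ⟨z, hz⟩ ((phaseAlgebra (coneOver Ω)).Y j (c (k, i) * d k)) =
      jacobian ψ z.1 k i * ∑ l, jacobian ψ z.1 l j *
        dy l (dy k fun w => F' w ^ 2) (prolong ψ z) := fun k => by
    rw [derivation_mul, hc0, mul_zero, add_zero, map_mul, hc, (hd k).dy j]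
    beta_reduce
    rw [(hsq.dy k).dy_prolong hψ hU hz]
  simp only [h3] at h2
  simp only [metricTensor, Matrix.of_apply, Matrix.mul_apply, Matrix.transpose_apply]
  rw [← h2, Finset.mul_sum]
  simp only [Finset.mul_sum, Finset.sum_mul]
  rw [Finset.sum_comm]
  exact Finset.sum_congr rfl fun l _ => Finset.sum_congr rfl fun k _ => by ring

theorem det_metricTensor_prolong (hψ : ContDiffOn ℝ ∞ ψ Ω)
    (hU : ∀ z ∈ coneOver Ω, prolong ψ z ∈ U)
    {F F' : Model n × Model n → ℝ} {a : smoothAlgebra U} (ha : Rep F' a)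
    (hF : ∀ z ∈ coneOver Ω, F z = F' (prolong ψ z)) {z : Model n × Model n}
    (hz : z ∈ coneOver Ω) :
    (metricTensor F z).det =
      (fderiv ℝ ψ z.1).det ^ 2 * (metricTensor F' (prolong ψ z)).det := by
  rw [metricTensor_prolong hψ hU ha hF hz, Matrix.det_mul, Matrix.det_mul, Matrix.det_transpose,
    det_jacobian]
  ring

/-! ### Transition maps between charts -/

variable {M : Type*} [TopologicalSpace M] [ChartedSpace (Model n) M]
  {e e' : OpenPartialHomeomorph M (Model n)}

/-- The domain of the transition map from the chart `e` to the chart `e'`. -/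
def overlap (e e' : OpenPartialHomeomorph M (Model n)) : Opens (Model n) :=
  ⟨e.target ∩ e.symm ⁻¹' e'.source, e.symm.isOpen_inter_preimage e'.open_source⟩

/-- The transition map from the chart `e` to the chart `e'`. -/
def transition (e e' : OpenPartialHomeomorph M (Model n)) : Model n → Model n := e' ∘ e.symm

omit [ChartedSpace (Model n) M] in
theorem coneOver_overlap_le : coneOver (overlap e e') ≤ phaseDomain e :=
  fun _ hz => ⟨hz.1.1, hz.2⟩

variable (he : e ∈ IsManifold.maximalAtlas (𝓡 n) ∞ M)
  (he' : e' ∈ IsManifold.maximalAtlas (𝓡 n) ∞ M)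
include he he'

theorem contDiffOn_transition : ContDiffOn ℝ ∞ (transition e e') (overlap e e') :=
  contMDiffOn_iff_contDiffOn.mp <| (contMDiffOn_of_mem_maximalAtlas he').comp
    ((contMDiffOn_symm_of_mem_maximalAtlas he).mono fun _ hx => hx.1) fun _ hx => hx.2

theorem coords_lift_eq_prolong {z : Model n × Model n} (hz : z ∈ coneOver (overlap e e')) :
    coords e' (lift e z) = prolong (transition e e') z := by
  have h1 : tangentMap (𝓡 n) (𝓡 n) e' (tangentMap (𝓡 n) (𝓡 n) e.symm
      (⟨z.1, z.2⟩ : TangentBundle (𝓡 n) (Model n))) =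
      tangentMap (𝓡 n) (𝓡 n) (transition e e') ⟨z.1, z.2⟩ :=
    (tangentMap_comp_at (⟨z.1, z.2⟩ : TangentBundle (𝓡 n) (Model n))
      (mdifferentiableAt_chart he' hz.1.2) (mdifferentiableAt_chart_symm he hz.1.1)).symm
  have h2 : coords e' (lift e z) = (transition e e' z.1,
      mfderiv (𝓡 n) (𝓡 n) (transition e e') z.1 z.2) :=
    congrArg (Bundle.TotalSpace.toProd (Model n) (Model n)) h1
  rw [h2, mfderiv_eq_fderiv]
  rfl

theorem lift_prolong {z : Model n × Model n} (hz : z ∈ coneOver (overlap e e')) :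
    lift e' (prolong (transition e e') z) = lift e z := by
  rw [← coords_lift_eq_prolong he he' hz, lift_coords he' (v := lift e z) hz.1.2]

theorem prolong_mem {z : Model n × Model n} (hz : z ∈ coneOver (overlap e e')) :
    prolong (transition e e') z ∈ coneOver (overlap e' e) := by
  have h1 : prolong (transition e e') z ∈ phaseDomain e' := by
    rw [← coords_lift_eq_prolong he he' hz]
    exact coords_mem he' hz.1.2 (lift_mem_slit he ⟨hz.1.1, hz.2⟩)
  refine ⟨⟨h1.1, ?_⟩, h1.2⟩
  have h2 : e'.symm (prolong (transition e e') z).1 = e.symm z.1 := e'.left_inv hz.1.2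
  rw [Set.mem_preimage, h2]
  exact e.map_target hz.1.1

theorem image_prolong : prolong (transition e e') '' (coneOver (overlap e e')) =
    coneOver (overlap e' e) := by
  apply Set.Subset.antisymm
  · rintro _ ⟨z, hz, rfl⟩
    exact prolong_mem he he' hz
  · intro z hz
    refine ⟨prolong (transition e' e) z, prolong_mem he' he hz, ?_⟩
    rw [← coords_lift_eq_prolong he he' (prolong_mem he' he hz), lift_prolong he' he hz,
      coords_lift he' hz.1.1]

theorem injOn_prolong : Set.InjOn (prolong (transition e e')) (coneOver (overlap e e')) := by
  intro z hz w hw h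
  rw [← coords_lift he hz.1.1, ← coords_lift he hw.1.1, ← lift_prolong he he' hz, h,
    lift_prolong he he' hw]

variable [IsManifold (𝓡 n) ∞ M] {F : TangentBundle (𝓡 n) M → ℝ}

theorem det_metricTensor_transition (hn : n ≠ 0) (hF : IsFinsler F) {z : Model n × Model n}
    (hz : z ∈ coneOver (overlap e e')) :
    (metricTensor (inChart e F) z).det = (fderiv ℝ (transition e e') z.1).det ^ 2 *
      (metricTensor (inChart e' F) (prolong (transition e e') z)).det :=
  det_metricTensor_prolong (contDiffOn_transition he he')
    (fun w hw => coneOver_overlap_le (prolong_mem he he' hw))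
    (hF.isLocalFinsler he' hn).rep_metric
    (fun w hw => by rw [inChart_eq, inChart_eq, lift_prolong he he' hw]) hz

/-- The Liouville measure `|det g| dx dy` does not depend on the chart. -/
theorem integral_transition (hn : n ≠ 0) (hF : IsFinsler F) (φ : Model n × Model n → ℝ) :
    ∫ z in coneOver (overlap e e'),
        φ (prolong (transition e e') z) * |(metricTensor (inChart e F) z).det| =
      ∫ z in coneOver (overlap e' e), φ z * |(metricTensor (inChart e' F) z).det| := by
  rw [← image_prolong he he', integral_image_eq_integral_abs_det_fderiv_smul volume
    (coneOver (overlap e e')).isOpen.measurableSet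
    (fun z hz => (hasFDerivAt_prolong (contDiffOn_transition he he') hz.1).hasFDerivWithinAt)
    (injOn_prolong he he')]
  refine setIntegral_congr_fun (coneOver (overlap e e')).isOpen.measurableSet fun z hz => ?_
  rw [det_metricTensor_transition he he' hn hF hz, det_prolongDeriv, abs_mul, smul_eq_mul]
  ring

end Finsler
end

noncomputable section

namespace Finsler

open TopologicalSpace Filter Topology MeasureTheory

variable {n : ℕ} {M : Type*} [TopologicalSpace M] [ChartedSpace (Model n) M]
  {e e' : OpenPartialHomeomorph M (Model n)}

/-! ### Functions on the manifold in charts -/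

/-- The derivative of a function on `M`, as a function on `TM`. -/
def differential (ρ : M → ℝ) (v : TangentBundle (𝓡 n) M) : ℝ :=
  mfderiv (𝓡 n) 𝓘(ℝ, ℝ) ρ v.1 v.2

theorem differential_eq_zero {ρ : M → ℝ} {v : TangentBundle (𝓡 n) M} (hv : v.1 ∉ tsupport ρ) :
    differential ρ v = 0 := by
  have h : ρ =ᶠ[𝓝 v.1] fun _ => (0 : ℝ) := by
    rw [notMem_tsupport_iff_eventuallyEq] at hv
    exact hv
  rw [differential, h.mfderiv_eq, mfderiv_const]
  rfl

/-- A smooth function on `M` as a function on an open cone of a chart of `TM`. -/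
theorem exists_rep_function (he : e ∈ IsManifold.maximalAtlas (𝓡 n) ∞ M) {Ω : Opens (Model n)}
    (hΩ : ∀ x ∈ Ω, x ∈ e.target) {ρ : M → ℝ} (hρ : ContMDiff (𝓡 n) 𝓘(ℝ, ℝ) ∞ ρ) :
    ∃ r : smoothAlgebra (coneOver Ω), Rep (fun z => ρ (e.symm z.1)) r ∧
      (∀ k, (phaseAlgebra (coneOver Ω)).Y k r = 0) ∧
      (∀ k z, ev z ((phaseAlgebra (coneOver Ω)).X k r) ≠ 0 → e.symm z.1.1 ∈ tsupport ρ) ∧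
      Rep (fun z => differential ρ (lift e z))
        (∑ k, (phaseAlgebra (coneOver Ω)).y k * (phaseAlgebra (coneOver Ω)).X k r) := by
  have hs : ContDiffOn ℝ ∞ (ρ ∘ e.symm) Ω := contMDiffOn_iff_contDiffOn.mp <|
    hρ.comp_contMDiffOn ((contMDiffOn_symm_of_mem_maximalAtlas he).mono hΩ)
  have hr := rep_ofFun (U := coneOver Ω) (φ := fun z => ρ (e.symm z.1))
    (hs.comp contDiff_fst.contDiffOn fun z hz => hz.1)
  refine ⟨_, hr, fun k => Rep.dy_eq_zero_of_fst (h := fun x => ρ (e.symm x)) hr k,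
    fun k z hz => ?_, fun z => ?_⟩
  · by_contra hmem
    apply hz
    rw [hr.dx k, dx]
    have hcont : ContinuousAt (fun z : Model n × Model n => e.symm z.1) z.1 :=
      ContinuousAt.comp (f := Prod.fst) (g := e.symm)
        (e.continuousAt_symm (hΩ _ z.2.1)) continuousAt_fst
    have h0 : (fun z : Model n × Model n => ρ (e.symm z.1)) =ᶠ[𝓝 z.1] fun _ => 0 :=
      hcont.eventually (notMem_tsupport_iff_eventuallyEq.mp hmem)
    rw [h0.fderiv_eq]
    simp
  · have h1 : ∀ k, ev z ((phaseAlgebra (coneOver Ω)).y k * (phaseAlgebra (coneOver Ω)).X k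
        (ofFun (U := coneOver Ω) (fun z => ρ (e.symm z.1))
          (hs.comp contDiff_fst.contDiffOn fun z hz => hz.1))) = z.1.2 k *
          fderiv ℝ (fun z : Model n × Model n => ρ (e.symm z.1)) z
            (EuclideanSpace.single k 1, 0) := fun k => by
      rw [map_mul, Rep.y, hr.dx]; rfl
    rw [map_sum]
    simp only [h1, sum_mul_fderiv_fst]
    have h2 : DifferentiableAt ℝ (ρ ∘ e.symm) z.1.1 :=
      (hs.contDiffAt (Ω.isOpen.mem_nhds z.2.1)).differentiableAt (by simp)
    have h3 := (h2.hasFDerivAt.comp z.1 hasFDerivAt_fst).fderiv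
    simp only [Function.comp_def] at h3
    rw [h3]
    have h4 : mfderiv (𝓡 n) 𝓘(ℝ, ℝ) (ρ ∘ e.symm) z.1.1 =
        (mfderiv (𝓡 n) 𝓘(ℝ, ℝ) ρ (e.symm z.1.1)).comp (mfderiv (𝓡 n) (𝓡 n) e.symm z.1.1) :=
      mfderiv_comp z.1.1 (hρ.mdifferentiableAt (by simp))
        (mdifferentiableAt_chart_symm he (hΩ _ z.2.1))
    have h5 : differential ρ (lift e z) = mfderiv (𝓡 n) 𝓘(ℝ, ℝ) (ρ ∘ e.symm) z.1.1 z.1.2 := by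
      rw [h4]; rfl
    rw [h5, mfderiv_eq_fderiv]
    rfl

theorem mem_compactIdeal_of_isCompact {Ω : Opens (Model n)} {F : TangentBundle (𝓡 n) M → ℝ}
    (hF : IsLocalFinsler (coneOver Ω) (inChart e F)) (hΩ : ∀ x ∈ Ω, x ∈ e.target) {P : Set M}
    (hP : IsCompact P) (hPe : P ⊆ e.source) (hPΩ : ∀ p ∈ P, e p ∈ Ω)
    {a : smoothAlgebra (coneOver Ω)}
    (ha : ∀ z, ev z a ≠ 0 → e.symm z.1.1 ∈ P ∧ inChart e F z ∈ Set.Icc 1 2) :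
    a ∈ compactIdeal (coneOver Ω) := by
  refine mem_compactIdeal hF (S := e '' P) (hP.image_of_continuousOn (e.continuousOn.mono hPe))
    (by rintro _ ⟨p, hp, rfl⟩; exact hPΩ p hp) one_pos fun z hz => ⟨?_, (ha z hz).2⟩
  exact ⟨_, (ha z hz).1, e.right_inv (hΩ _ z.2.1)⟩

/-! ### A cutoff -/

/-- A bump function supported in `(0, ∞)`. -/
def bump : ContDiffBump (1 : ℝ) where
  rIn := 1 / 4
  rOut := 1 / 2
  rIn_pos := by norm_num
  rIn_lt_rOut := by norm_num

/-- The support is [1/2, 3/2], so t lies between 1 and √3. -/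
theorem mem_Icc_of_mem_tsupport {t : ℝ} (ht : 0 < t) (h : t ^ 2 / 2 ∈ tsupport bump) :
    t ∈ Set.Icc 1 2 := by
  rw [bump.tsupport_eq, Metric.mem_closedBall, Real.dist_eq, abs_le] at h
  have : bump.rOut = 1 / 2 := rfl
  rw [this] at h
  constructor <;> nlinarith [h.1, h.2]

theorem mem_Icc_of_bump_ne_zero {t : ℝ} (ht : 0 < t) (h : bump (t ^ 2 / 2) ≠ 0) :
    t ∈ Set.Icc 1 2 :=
  mem_Icc_of_mem_tsupport ht (subset_tsupport _ h)

theorem mem_Icc_of_deriv_bump_ne_zero {t : ℝ} (ht : 0 < t) (h : deriv bump (t ^ 2 / 2) ≠ 0) :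
    t ∈ Set.Icc 1 2 :=
  mem_Icc_of_mem_tsupport ht (support_deriv_subset h)

/-! ### The divergence theorem on the tangent bundle -/

variable [IsManifold (𝓡 n) ∞ M] {F f : TangentBundle (𝓡 n) M → ℝ} {ρ σ : M → ℝ}

/-- The density `|det g|` of the Liouville measure in a chart. -/
def liouvilleDensity (e : OpenPartialHomeomorph M (Model n)) (F : TangentBundle (𝓡 n) M → ℝ)
    (z : Model n × Model n) : ℝ :=
  |(metricTensor (inChart e F) z).det|

/-- The function `½ log |det g|` in a chart. -/
def logDensity (e : OpenPartialHomeomorph M (Model n)) (F : TangentBundle (𝓡 n) M → ℝ)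
    (z : Model n × Model n) : ℝ :=
  1 / 2 * Real.log (metricTensor (inChart e F) z).det

/-- The function `f σ (dρ) θ'(F²/2)`. -/
def flux (F f : TangentBundle (𝓡 n) M → ℝ) (ρ σ : M → ℝ) (v : TangentBundle (𝓡 n) M) : ℝ :=
  f v * σ v.1 * differential ρ v * deriv bump (F v ^ 2 / 2)

omit [IsManifold (𝓡 n) ∞ M] in
theorem flux_ne_zero {v : TangentBundle (𝓡 n) M} (hv : 0 < F v) (h : flux F f ρ σ v ≠ 0) :
    v.1 ∈ tsupport ρ ∩ tsupport σ ∧ F v ∈ Set.Icc 1 2 := by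
  simp only [flux, mul_ne_zero_iff] at h
  refine ⟨⟨?_, subset_tsupport _ h.1.1.2⟩, mem_Icc_of_deriv_bump_ne_zero hv h.2⟩
  by_contra hmem
  exact h.1.2 (differential_eq_zero hmem)

variable [CompactSpace M]

theorem integrableOn_flux (hn : n ≠ 0) (he : e ∈ IsManifold.maximalAtlas (𝓡 n) ∞ M)
    (hF : IsFinsler F) {a : smoothAlgebra (phaseDomain e)} (ha : Rep (inChart e f) a)
    (hρ : ContMDiff (𝓡 n) 𝓘(ℝ, ℝ) ∞ ρ) (hσ : ContMDiff (𝓡 n) 𝓘(ℝ, ℝ) ∞ σ)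
    (hs : tsupport ρ ∩ tsupport σ ⊆ e.source) :
    IntegrableOn (fun z => flux F f ρ σ (lift e z) * logDensity e F z * liouvilleDensity e F z)
      (phaseDomain e) := by
  have h := hF.isLocalFinsler he hn
  obtain ⟨W, L, hW, hL, -⟩ := h.exists_isLiouville
  obtain ⟨-, θ₁, -, -, h1, -⟩ := h.exists_isCutoff (θ := bump) bump.contDiff
  obtain ⟨r, -, -, -, hr⟩ := exists_rep_function he (Ω := ⟨e.target, e.open_target⟩)
    (fun _ hx => hx) hρ
  obtain ⟨s, hs', -⟩ := exists_rep_function he (Ω := ⟨e.target, e.open_target⟩)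
    (fun _ hx => hx) hσ
  have hq : Rep (fun z => flux F f ρ σ (lift e z)) _ := ((ha.mul hs').mul hr).mul h1
  refine Rep.integrableOn ((hq.mul hL).mul hW) (Ideal.mul_mem_right _ _ (Ideal.mul_mem_right _ _ ?_))
  refine mem_compactIdeal_of_isCompact h (fun _ hx => hx)
    ((isClosed_tsupport ρ).inter (isClosed_tsupport σ)).isCompact hs
    (fun p hp => e.map_source (hs hp)) fun z hz => ?_
  exact flux_ne_zero (h.pos z z.2) fun h0 => hz ((hq z).trans h0)

/-- The contribution of `flux` does not depend on the chart. -/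
theorem integral_flux (hn : n ≠ 0) (he : e ∈ IsManifold.maximalAtlas (𝓡 n) ∞ M)
    (he' : e' ∈ IsManifold.maximalAtlas (𝓡 n) ∞ M) (hF : IsFinsler F)
    {a : smoothAlgebra (phaseDomain e)} (ha : Rep (inChart e f) a)
    (haY : ∀ k, (phaseAlgebra (phaseDomain e)).Y k a = 0)
    (hρ : ContMDiff (𝓡 n) 𝓘(ℝ, ℝ) ∞ ρ) (hσ : ContMDiff (𝓡 n) 𝓘(ℝ, ℝ) ∞ σ)
    (hρe : tsupport ρ ⊆ e.source) (hσe : tsupport σ ⊆ e'.source) :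
    ∫ z in phaseDomain e, flux F f ρ σ (lift e z) * logDensity e F z * liouvilleDensity e F z =
      ∫ z in phaseDomain e',
        flux F f ρ σ (lift e' z) * logDensity e' F z * liouvilleDensity e' F z := by
  have hΩ : ∀ x ∈ overlap e e', x ∈ e.target := fun _ hx => hx.1
  have hF' := hF.isLocalFinsler he' hn
  have h := (hF.isLocalFinsler he hn).mono (coneOver_overlap_le (e := e) (e' := e'))
  have hψ := contDiffOn_transition he he'
  have hT : ∀ z ∈ coneOver (overlap e e'), prolong (transition e e') z ∈ phaseDomain e' :=
    fun z hz => coneOver_overlap_le (prolong_mem he he' hz)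
  obtain ⟨W, L, hW, hL, hWL⟩ := h.exists_isLiouville
  obtain ⟨θ₀, θ₁, θ₂, h0, h1, hθ⟩ := h.exists_isCutoff (θ := bump) bump.contDiff
  obtain ⟨r, hr, hrY, hrX, hdr⟩ := exists_rep_function he hΩ hρ
  obtain ⟨s, hs, hsY, -⟩ := exists_rep_function he hΩ hσ
  obtain ⟨-, L', -, hL', -⟩ := hF'.exists_isLiouville
  obtain ⟨Lt, hLt⟩ := hL'.exists_prolong hψ hT
  have hb : Rep (inChart e f) (ofFun (U := coneOver (overlap e e')) _
      (ha.contDiffOn.mono coneOver_overlap_le)) := rep_ofFun _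
  set b := ofFun (U := coneOver (overlap e e')) _ (ha.contDiffOn.mono coneOver_overlap_le)
  have hbY : ∀ k, (phaseAlgebra (coneOver (overlap e e'))).Y k b = 0 := fun k => ev_ext fun z => by
    have := ha.dy k ⟨z, coneOver_overlap_le z.2⟩
    rw [haY, map_zero] at this
    rw [hb.dy k, map_zero, this]
  -- The logarithmic densities of the two charts differ by the logarithm of the absolute Jacobian
  -- determinant of the transition map, a function of x alone.
  have hℓ : Rep (fun z => 1 / 2 * Real.log ((fderiv ℝ (transition e e') z.1).det ^ 2)) (L - Lt) := by
    refine (hL.sub hLt).congr fun z hz => ?_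
    have hd := det_metricTensor_transition he he' hn hF hz
    have hd0 := h.nondegenerate z hz
    rw [hd, mul_ne_zero_iff] at hd0
    rw [hd, Real.log_mul hd0.1 hd0.2]
    ring
  have hℓY := Rep.dy_eq_zero_of_fst
    (h := fun x => 1 / 2 * Real.log ((fderiv ℝ (transition e e') x).det ^ 2)) hℓ
  have hq : Rep (fun z => flux F f ρ σ (lift e z)) _ := ((hb.mul hs).mul hdr).mul h1
  have hsub : tsupport ρ ∩ tsupport σ ⊆ e.source := fun p hp => hρe hp.1
  have hmem : ∀ p ∈ tsupport ρ ∩ tsupport σ, e p ∈ overlap e e' := fun p hp =>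
    ⟨e.map_source (hρe hp.1), by
      rw [Set.mem_preimage, e.left_inv (hρe hp.1)]; exact hσe hp.2⟩
  have hcpt : IsCompact (tsupport ρ ∩ tsupport σ) :=
    ((isClosed_tsupport ρ).inter (isClosed_tsupport σ)).isCompact
  have hqK := mem_compactIdeal_of_isCompact h hΩ hcpt hsub hmem (a := _) fun z hz => by
    rw [hq z] at hz
    exact flux_ne_zero (h.pos z z.2) hz
  set q := b * s * (∑ k, (phaseAlgebra (coneOver (overlap e e'))).y k *
    (phaseAlgebra (coneOver (overlap e e'))).X k r) * θ₁ with hqdef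
  -- The difference of the two integrands is fibrewise linear times the cutoff: dρ is linear in y,
  -- and f, σ and the difference of logarithmic densities do not depend on y. Its integral therefore
  -- vanishes.
  have hlin := (stokes (coneOver (overlap e e'))).linear (Φ := h.algebra) hWL hθ
    (b := fun k => b * s * (L - Lt) * (phaseAlgebra (coneOver (overlap e e'))).X k r)
    (fun k => mem_compactIdeal_of_isCompact h hΩ hcpt hsub hmem fun z hz => by
      simp only [map_mul, mul_ne_zero_iff] at hz
      obtain ⟨⟨⟨⟨-, h2⟩, -⟩, h3⟩, h4⟩ := hz
      rw [hs] at h2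
      rw [h0] at h4
      exact ⟨⟨hrX k z h3, subset_tsupport _ h2⟩, mem_Icc_of_bump_ne_zero (h.pos z z.2) h4⟩)
    (fun j k => by
      have e1 : h.algebra.Y j b = 0 := hbY j
      have e2 : h.algebra.Y j s = 0 := hsY j
      have e3 : h.algebra.Y j (L - Lt) = 0 := hℓY j
      have e4 : h.algebra.Y j ((phaseAlgebra (coneOver (overlap e e'))).X k r) = 0 := by
        have := (phaseAlgebra (coneOver (overlap e e'))).Y_X j k r
        rw [hrY, map_zero] at this
        exact this
      simp only [derivation_mul, e1, e2, e3, e4]; ring)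
  have hlin' : ∫ z, zeroExt (q * (L - Lt) * W) z = 0 := by
    have heq : q * (L - Lt) * W = (∑ k, b * s * (L - Lt) *
        (phaseAlgebra (coneOver (overlap e e'))).X k r * h.algebra.y k) * θ₁ * W := by
      rw [hqdef]
      simp only [Finset.mul_sum, Finset.sum_mul]
      exact Finset.sum_congr rfl fun k _ => by
        change _ = b * s * (L - Lt) * (phaseAlgebra (coneOver (overlap e e'))).X k r *
          (phaseAlgebra (coneOver (overlap e e'))).y k * θ₁ * W
        ring
    rw [heq]
    exact hlin
  have hstep : ∫ z in coneOver (overlap e e'),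
      flux F f ρ σ (lift e z) * logDensity e F z * liouvilleDensity e F z =
      ∫ z in coneOver (overlap e e'), flux F f ρ σ (lift e z) *
        logDensity e' F (prolong (transition e e') z) * liouvilleDensity e F z := by
    have e1 : q * L * W = q * (L - Lt) * W + q * Lt * W := by ring
    have e2 := (stokes (coneOver (overlap e e'))).add (q * (L - Lt) * W)
      (Ideal.mul_mem_right _ _ (Ideal.mul_mem_right _ _ hqK)) (q * Lt * W)
      (Ideal.mul_mem_right _ _ (Ideal.mul_mem_right _ _ hqK))
    rw [← e1, hlin', zero_add, integral_zeroExt ((hq.mul hL).mul hW),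
      integral_zeroExt ((hq.mul hLt).mul hW)] at e2
    exact e2
  -- The flux lives over the intersection of the two supports, so each integral reduces to the
  -- overlap of the charts.
  have hout : ∀ e₁ e₂ : OpenPartialHomeomorph M (Model n),
      e₁ ∈ IsManifold.maximalAtlas (𝓡 n) ∞ M → tsupport ρ ∩ tsupport σ ⊆ e₂.source →
      ∫ z in phaseDomain e₁, flux F f ρ σ (lift e₁ z) * logDensity e₁ F z *
        liouvilleDensity e₁ F z = ∫ z in coneOver (overlap e₁ e₂),
          flux F f ρ σ (lift e₁ z) * logDensity e₁ F z * liouvilleDensity e₁ F z := by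
    intro e₁ e₂ he₁ hsupp
    refine setIntegral_eq_of_subset_of_forall_sdiff_eq_zero (phaseDomain e₁).isOpen.measurableSet
      coneOver_overlap_le fun z hz => ?_
    have : flux F f ρ σ (lift e₁ z) = 0 := by
      by_contra hne
      have h2 := flux_ne_zero ((hF.isLocalFinsler he₁ hn).pos z hz.1) hne
      exact hz.2 ⟨⟨hz.1.1, hsupp h2.1⟩, hz.1.2⟩
    rw [this, zero_mul, zero_mul]
  rw [hout e e' he fun p hp => hσe hp.2, hout e' e he' fun p hp => hρe hp.1, hstep]
  have htr := integral_transition he he' hn hF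
    (fun z => flux F f ρ σ (lift e' z) * logDensity e' F z)
  rw [show ∫ z in coneOver (overlap e' e), flux F f ρ σ (lift e' z) * logDensity e' F z *
    liouvilleDensity e' F z = _ from htr.symm]
  refine setIntegral_congr_fun (coneOver (overlap e e')).isOpen.measurableSet fun z hz => ?_
  rw [lift_prolong he he' hz]
  rfl

end Finsler
end

/-! ### The integral identity in a single chart. -/

noncomputable section

namespace Finsler

open TopologicalSpace Filter Topology MeasureTheory

variable {n : ℕ} {M : Type*} [TopologicalSpace M] [ChartedSpace (Model n) M]
  {e : OpenPartialHomeomorph M (Model n)} [IsManifold (𝓡 n) ∞ M] [CompactSpace M]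
  {F f : TangentBundle (𝓡 n) M → ℝ} {ρ : M → ℝ}

/-- The identity behind the vanishing of `f`, localized to a chart. -/
theorem integral_flux_one (hn : 2 < n) (he : e ∈ IsManifold.maximalAtlas (𝓡 n) ∞ M)
    (hF : IsFinsler F) (hχ : ChiVanishes F) (hf : HasScalarMeanBerwald F f)
    (hρ : ContMDiff (𝓡 n) 𝓘(ℝ, ℝ) ∞ ρ) (hρe : tsupport ρ ⊆ e.source) :
    ∃ c ∈ compactIdeal (phaseDomain e),
      Rep (fun z => f (lift e z) * f (lift e z) * ρ (e.symm z.1) * bump (F (lift e z) ^ 2 / 2) *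
        (F (lift e z))⁻¹ * liouvilleDensity e F z) c ∧
      ∫ z in phaseDomain e,
        flux F f ρ 1 (lift e z) * logDensity e F z * liouvilleDensity e F z =
          (n - 1 : ℝ) * ∫ z, zeroExt c z := by
  have h := hF.isLocalFinsler he (n := n) (by omega)
  obtain ⟨a, ha, -, hess, h0⟩ := exists_rep_chart hn.le he h hχ hf
  obtain ⟨hX, hY⟩ := h0 hn
  obtain ⟨W, L, hW, hL, hWL⟩ := h.exists_isLiouville
  obtain ⟨θ₀, θ₁, θ₂, hθ0, hθ1, hθ⟩ := h.exists_isCutoff (θ := bump) bump.contDiff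
  obtain ⟨r, hr, hrY, hdr⟩ : ∃ r : smoothAlgebra (phaseDomain e),
      Rep (fun z => ρ (e.symm z.1)) r ∧ (∀ k, (phaseAlgebra (phaseDomain e)).Y k r = 0) ∧
      Rep (fun z => differential ρ (lift e z))
        (∑ k, (phaseAlgebra (phaseDomain e)).y k * (phaseAlgebra (phaseDomain e)).X k r) := by
    obtain ⟨r, hr, hrY, -, hdr⟩ := exists_rep_function he (Ω := ⟨e.target, e.open_target⟩)
      (fun _ hx => hx) hρ
    exact ⟨r, hr, hrY, hdr⟩
  have hinv : Rep (fun z => (F (lift e z))⁻¹) h.algebra.Finv := fun z => by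
    have h1 := congrArg (ev z) h.algebra.F_inv
    rw [map_mul, map_one] at h1
    have h2 : ev z h.algebra.F = F (lift e z) := h.rep_metric z
    rw [h2] at h1
    exact (inv_eq_of_mul_eq_one_right h1).symm
  -- On a function of x the spray acts as its differential.
  have hS : h.algebra.S r = ∑ k, (phaseAlgebra (phaseDomain e)).y k *
      (phaseAlgebra (phaseDomain e)).X k r := by
    have h1 : ∀ k, h.algebra.Y k r = 0 := hrY
    rw [FinslerAlgebra.S_apply]
    simp only [h1, mul_zero, Finset.sum_const_zero, sub_zero]
    rfl
  have hcpt : IsCompact (tsupport ρ) := (isClosed_tsupport ρ).isCompact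
  have hmem : ∀ {b : smoothAlgebra (phaseDomain e)}, (∀ z, ev z b ≠ 0 →
      e.symm z.1.1 ∈ tsupport ρ ∧ inChart e F z ∈ Set.Icc 1 2) → b ∈ compactIdeal (phaseDomain e) :=
    fun hb => mem_compactIdeal_of_isCompact h (fun _ hx => hx) hcpt hρe
      (fun p hp => e.map_source (hρe hp)) hb
  have hd : Rep (fun z => differential ρ (lift e z)) (h.algebra.S r) := by rw [hS]; exact hdr
  have m0 : r * θ₀ ∈ compactIdeal (phaseDomain e) := hmem fun z hz => by
    rw [map_mul, hr, hθ0, mul_ne_zero_iff] at hz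
    exact ⟨subset_tsupport _ hz.1, mem_Icc_of_bump_ne_zero (h.pos z z.2) hz.2⟩
  have m1 : r * θ₁ ∈ compactIdeal (phaseDomain e) := hmem fun z hz => by
    rw [map_mul, hr, hθ1, mul_ne_zero_iff] at hz
    exact ⟨subset_tsupport _ hz.1, mem_Icc_of_deriv_bump_ne_zero (h.pos z z.2) hz.2⟩
  have m2 : h.algebra.S r * θ₁ ∈ compactIdeal (phaseDomain e) := hmem fun z hz => by
    rw [map_mul, hd, hθ1, mul_ne_zero_iff] at hz
    refine ⟨?_, mem_Icc_of_deriv_bump_ne_zero (h.pos z z.2) hz.2⟩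
    by_contra hmem
    exact hz.1 (differential_eq_zero (v := lift e z) hmem)
  have key := (stokes (phaseDomain e)).scalar (Φ := h.algebra) hWL hθ hX hY hess m0 m1 m2 hrY
  refine ⟨_, ?_, ((((ha.mul ha).mul hr).mul hθ0).mul hinv).mul hW, ?_⟩
  · have : a * a * r * θ₀ * h.algebra.Finv * W = a * a * h.algebra.Finv * W * (r * θ₀) := by ring
    rw [this]
    exact Ideal.mul_mem_left _ _ m0
  · rw [← key]
    have hq := (((ha.mul hd).mul hθ1).mul hL).mul hW
    rw [integral_zeroExt hq]
    refine setIntegral_congr_fun (phaseDomain e).isOpen.measurableSet fun z _ => ?_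
    simp only [flux, Pi.one_apply, mul_one]
    rfl

end Finsler
end

/-! ### Partitions of unity and the vanishing of f on compact manifolds. -/

noncomputable section

namespace Finsler

open TopologicalSpace Filter Topology MeasureTheory

variable {n : ℕ} {M : Type*} [TopologicalSpace M] [ChartedSpace (Model n) M]

theorem differential_sum {ι : Type*} (s : Finset ι) {ρ : ι → M → ℝ}
    (hρ : ∀ i, ContMDiff (𝓡 n) 𝓘(ℝ, ℝ) ∞ (ρ i)) (v : TangentBundle (𝓡 n) M) :
    differential (∑ i ∈ s, ρ i) v = ∑ i ∈ s, differential (ρ i) v := by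
  classical
  have hd : ∀ i, HasMFDerivAt (𝓡 n) 𝓘(ℝ, ℝ) (ρ i) v.1 (mfderiv (𝓡 n) 𝓘(ℝ, ℝ) (ρ i) v.1) :=
    fun i => ((hρ i).mdifferentiableAt (by simp)).hasMFDerivAt
  suffices h : ∃ D, HasMFDerivAt (𝓡 n) 𝓘(ℝ, ℝ) (∑ i ∈ s, ρ i) v.1 D ∧
      D v.2 = ∑ i ∈ s, differential (ρ i) v by
    obtain ⟨D, hD, h⟩ := h
    rw [differential, hD.mfderiv, h]
  induction s using Finset.induction_on with
  | empty => exact ⟨0, hasMFDerivAt_const (0 : ℝ) v.1, rfl⟩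
  | insert i s hi ih =>
    obtain ⟨D, hD, h⟩ := ih
    rw [Finset.sum_insert hi, Finset.sum_insert hi, ← h]
    exact ⟨_, (hd i).add hD, rfl⟩

theorem exists_partition_chartAt [T2Space M] [CompactSpace M] [IsManifold (𝓡 n) ∞ M] :
    ∃ (s : Finset M) (ρ : M → M → ℝ), (∀ p, ContMDiff (𝓡 n) 𝓘(ℝ, ℝ) ∞ (ρ p)) ∧
      (∀ p q, 0 ≤ ρ p q) ∧ (∀ p, tsupport (ρ p) ⊆ (chartAt (Model n) p).source) ∧
      ∑ p ∈ s, ρ p = 1 := by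
  obtain ⟨f, hf⟩ := SmoothPartitionOfUnity.exists_isSubordinate_chartAt_source (𝓡 n) M
  refine ⟨(f.locallyFinite.finite_nonempty_of_compact).toFinset, fun p => f p,
    fun p => (f p).contMDiff, f.nonneg, hf, ?_⟩
  funext q
  rw [Finset.sum_apply, Pi.one_apply, ← f.sum_eq_one (Set.mem_univ q)]
  refine (finsum_eq_sum_of_support_subset _ fun p hp => ?_).symm
  rw [Set.Finite.coe_toFinset]
  exact ⟨q, hp⟩

variable [T2Space M] [CompactSpace M] [IsManifold (𝓡 n) ∞ M]
  {F f : TangentBundle (𝓡 n) M → ℝ}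

theorem eq_zero_of_compactSpace (hn : 2 < n) (hF : IsFinsler F) (hχ : ChiVanishes F)
    (hf : HasScalarMeanBerwald F f) {v : TangentBundle (𝓡 n) M} (hv : v ∈ slit n M) : f v = 0 := by
  obtain ⟨s, ρ, hρ, hρ0, hρs, hρ1⟩ := exists_partition_chartAt (n := n) (M := M)
  have hn0 : n ≠ 0 := by omega
  have he : ∀ p, chartAt (Model n) p ∈ IsManifold.maximalAtlas (𝓡 n) ∞ M := fun p =>
    IsManifold.chart_mem_maximalAtlas p
  have hrep := fun p => exists_rep_chart hn.le (he p) (hF.isLocalFinsler (he p) hn0) hχ hf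
  choose a ha _ _ h0 using hrep
  have hint : ∀ p q r, tsupport (ρ p) ∩ tsupport (ρ q) ⊆ (chartAt (Model n) r).source →
      IntegrableOn (fun z => flux F f (ρ p) (ρ q) (lift (chartAt (Model n) r) z) *
        logDensity (chartAt (Model n) r) F z * liouvilleDensity (chartAt (Model n) r) F z)
        (phaseDomain (chartAt (Model n) r)) := fun p q r h =>
    integrableOn_flux hn0 (he r) hF (ha r) (hρ p) (hρ q) h
  -- In `J p q r` the differential falls on ρ_p, the function ρ_q is a weight, and r is the chart of
  -- integration.
  set J : M → M → M → ℝ := fun p q r => ∫ z in phaseDomain (chartAt (Model n) r),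
    flux F f (ρ p) (ρ q) (lift (chartAt (Model n) r) z) *
      logDensity (chartAt (Model n) r) F z * liouvilleDensity (chartAt (Model n) r) F z with hJ
  have h1 : ∀ p q, J p q p = J p q q := fun p q =>
    integral_flux hn0 (he p) (he q) hF (ha p) ((h0 p hn).2) (hρ p) (hρ q) (hρs p) (hρs q)
  -- With the chart q fixed, the differentials dρ_p add up to d(1) = 0.
  have h2 : ∀ q, ∑ p ∈ s, J p q q = 0 := fun q => by
    rw [hJ, ← integral_finsetSum _ fun p _ => hint p q q fun x hx => hρs q hx.2]
    refine (integral_congr_ae (Eventually.of_forall fun z => ?_)).trans (integral_zero _ _)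
    have h3 : ∑ p ∈ s, differential (ρ p) (lift (chartAt (Model n) q) z) = 0 := by
      rw [← differential_sum s hρ, hρ1]
      have : (1 : M → ℝ) = fun _ => (1 : ℝ) := rfl
      rw [differential, this, mfderiv_const]
      rfl
    simp only [flux, ← Finset.sum_mul, ← Finset.mul_sum, h3]
    simp
  have h3 : ∀ p, ∑ q ∈ s, J p q p = ∫ z in phaseDomain (chartAt (Model n) p),
      flux F f (ρ p) 1 (lift (chartAt (Model n) p) z) *
        logDensity (chartAt (Model n) p) F z * liouvilleDensity (chartAt (Model n) p) F z :=
    fun p => by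
    rw [hJ, ← integral_finsetSum _ fun q _ => hint p q p fun x hx => hρs p hx.1]
    refine integral_congr_ae (Eventually.of_forall fun z => ?_)
    have h4 : ∑ q ∈ s, ρ q (lift (chartAt (Model n) p) z).1 = 1 := by
      rw [← Finset.sum_apply, hρ1, Pi.one_apply]
    simp only [flux, ← Finset.sum_mul, ← Finset.mul_sum, h4, Pi.one_apply]
  have hc := fun p => integral_flux_one hn (he p) hF hχ hf (hρ p) (hρs p)
  choose c hcK hc hcI using hc
  have hnn : ∀ p z, 0 ≤ zeroExt (c p) z := fun p z => by
    by_cases hz : z ∈ phaseDomain (chartAt (Model n) p)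
    · rw [zeroExt_of_mem _ hz, hc p]
      refine mul_nonneg (mul_nonneg (mul_nonneg (mul_nonneg (mul_self_nonneg _) (hρ0 _ _))
        bump.nonneg) (inv_nonneg.mpr (hF.nonneg _))) (abs_nonneg _)
    · rw [zeroExt_of_notMem _ hz]
  -- Inserting the weights ρ_q with sum 1 turns the identity of chart p into a sum of `J p q p`.
  -- Moving each term to chart q and exchanging the sums gives zero. All summands are nonnegative,
  -- so each vanishes.
  have h4 : ∑ p ∈ s, (n - 1 : ℝ) * ∫ z, zeroExt (c p) z = 0 := by
    have h6 : ∀ p, (n - 1 : ℝ) * ∫ z, zeroExt (c p) z = ∑ q ∈ s, J p q q := fun p => by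
      rw [← hcI, ← h3]
      exact Finset.sum_congr rfl fun q _ => h1 p q
    simp only [h6]
    rw [Finset.sum_comm]
    exact Finset.sum_eq_zero fun q _ => h2 q
  have hpos : (0 : ℝ) < n - 1 := by
    have : (2 : ℝ) < n := by exact_mod_cast hn
    linarith
  have h5 : ∀ p ∈ s, ∫ z, zeroExt (c p) z = 0 := fun p hp => by
    have := (Finset.sum_eq_zero_iff_of_nonneg fun p _ =>
      mul_nonneg hpos.le (integral_nonneg (hnn p))).mp h4 p hp
    exact (mul_eq_zero.mp this).resolve_left hpos.ne'
  by_contra hne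
  obtain ⟨p, hp, hpv⟩ : ∃ p ∈ s, ρ p v.1 ≠ 0 := by
    by_contra! hall
    have := congrFun hρ1 v.1
    rw [Finset.sum_apply, Finset.sum_eq_zero hall] at this
    exact zero_ne_one this
  have hvs : v.1 ∈ (chartAt (Model n) p).source := hρs p (subset_tsupport _ hpv)
  set e := chartAt (Model n) p
  have hloc := hF.isLocalFinsler (he p) hn0
  have hz := coords_mem (he p) hvs hv
  have hlz := lift_coords (he p) hvs
  have hFv : 0 < F v := by
    have := hloc.pos _ hz
    rwa [inChart_eq, hlz] at this
  -- Rescaling v to F = √2 puts F²/2 at the centre 1 of the bump; f is unchanged since it has degree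
  -- 0.
  set t := √2 / F v
  have ht : 0 < t := by positivity
  have hz' : ((coords e v).1, t • (coords e v).2) ∈ phaseDomain e :=
    ⟨hz.1, smul_ne_zero ht.ne' hz.2⟩
  have hFz : F (lift e ((coords e v).1, t • (coords e v).2)) = √2 := by
    have := hloc.homogeneous _ hz t ht
    rw [inChart_eq, inChart_eq, hlz] at this
    rw [this, div_mul_cancel₀ _ hFv.ne']
  have hfz : f (lift e ((coords e v).1, t • (coords e v).2)) = f v := by
    have := inChart_smul (he p) hf.1 _ hz t ht
    rwa [inChart_eq, inChart_eq, hlz, pow_zero, one_mul] at this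
  have hval : zeroExt (c p) ((coords e v).1, t • (coords e v).2) ≠ 0 := by
    rw [zeroExt_of_mem _ hz', hc p]
    beta_reduce
    have hb : bump 1 = 1 := bump.eventuallyEq_one.eq_of_nhds
    have hx : e.symm (coords e v).1 = v.1 := e.left_inv hvs
    rw [hFz, hfz, Real.sq_sqrt zero_le_two, div_self two_ne_zero, hb, hx]
    refine mul_ne_zero (mul_ne_zero (mul_ne_zero (mul_ne_zero (mul_ne_zero hne hne) hpv)
      one_ne_zero) (by positivity)) (abs_ne_zero.mpr (hloc.nondegenerate _ hz'))
  exact ((contDiff_zeroExt (hcK p)).continuous.integral_pos_of_hasCompactSupport_nonneg_nonzero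
    (hasCompactSupport_zeroExt (hcK p)) (hnn p) hval).ne' (h5 p hp)

end Finsler
end

theorem theorem2 {n : ℕ} (hn : 2 ≤ n) {M : Type*} [TopologicalSpace M] [T2Space M]
    [ChartedSpace (EuclideanSpace ℝ (Fin n)) M] [IsManifold (𝓡 n) ∞ M]
    (F f : TangentBundle (𝓡 n) M → ℝ) (hF : Finsler.IsFinsler F)
    (hchi : Finsler.ChiVanishes F) (hf : Finsler.HasScalarMeanBerwald F f) :
    Finsler.IsFirstIntegral F f ∧
    (2 < n → ConnectedSpace M → ∃ c : ℝ, ∀ v ∈ Finsler.slit n M, f v = c) ∧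
    (2 < n → CompactSpace M → ∀ v ∈ Finsler.slit n M, f v = 0) := by
  refine ⟨Finsler.isFirstIntegral hn hF hchi hf, fun hn' _ => ?_, fun hn' _ v hv => ?_⟩
  · obtain ⟨κ, hκ, h⟩ := Finsler.exists_isLocallyConstant hn' hF hchi hf
    obtain ⟨p⟩ := (inferInstance : Nonempty M)
    exact ⟨κ p, fun v hv => (h v hv).trans (hκ.apply_eq_of_preconnectedSpace _ _)⟩
  · exact Finsler.eq_zero_of_compactSpace hn' hF hchi hf hv
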